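/- Let $G$ be a connected, simply connected, solvable complex Lie group with Lie algebra $\mathfrak g$, let $G_0\subset G$ be a connected (simply connected) real Lie subgroup with Lie algebra $\mathfrak g_0\subset\mathfrak g$ such that $\mathfrak g_0+i\mathfrak g_0=\mathfrak g$, and let $\Gamma$ be a discrete cocompact subgroup of $G_0$. Put $\mathfrak m:=\mathfrak g_0\cap i\mathfrak g_0$, let $\mathfrak z$ be the center of $\mathfrak g$, and let $[\mathfrak g,\mathfrak m]$ be the linear span of all brackets $[X,Y]$ with $X\in\mathfrak g$, $Y\in\mathfrak m$. Assume that the triple $(\Gamma,G_0,G)$ is locally Kähler, i.e. that $Y=G_0/\Gamma$ has an open neighbourhood in the complex manifold $X=G/\Gamma$ which carries a Kähler form. Then: 1. For every right-$G_0$-invariant Kähler form $\omega$ on a right-$G_0$-invariant open neighbourhood of $G_0$ in $G$, with $\omega$ evaluated at the identity on $\mathfrak g=T_eG$, $$\mathfrak z\cap\mathfrak m=\{X\in\mathfrak m : \omega(X,[\mathfrak g,\mathfrak m])=0\}.$$ 2. In particular, if $\mathfrak z=0$, then $[\mathfrak g,\mathfrak m]=\mathfrak m$. -/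

import Mathlib

open scoped Manifold ContDiff Topology

noncomputable section

namespace CRSolv

/-! ### Linear algebra of real subspaces of a complex Lie algebra -/

section LieAlg

variable {L : Type*} [AddCommGroup L] [Module ℂ L]

variable (L) in
/-- Multiplication by `i`, as a real linear map. -/
def mulI : L →ₗ[ℝ] L :=
  (Complex.I • (LinearMap.id : L →ₗ[ℂ] L)).restrictScalars ℝ

/-- `𝔪 = 𝔤₀ ∩ i𝔤₀`. -/
def maxComplex (g₀ : Submodule ℝ L) : Submodule ℝ L := g₀ ⊓ g₀.map (mulI L)

/-- `𝔤₀` is generic in `𝔤`: `𝔤₀ + i𝔤₀ = 𝔤`. -/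
def IsGeneric (g₀ : Submodule ℝ L) : Prop := g₀ ⊔ g₀.map (mulI L) = ⊤

/-- `[𝔤, 𝔪]`: the linear span of all brackets `[X, Y]` with `X ∈ 𝔤` and `Y ∈ 𝔪`. -/
def bracketSpan [Bracket L L] (m : Submodule ℝ L) : Submodule ℝ L :=
  Submodule.span ℝ {W : L | ∃ X : L, ∃ Y ∈ m, W = ⁅X, Y⁆}

end LieAlg

/-! ### Real two-forms on complex manifolds -/

section Forms

variable {E : Type*} [NormedAddCommGroup E] [NormedSpace ℂ E]
  {G : Type*} [TopologicalSpace G] [ChartedSpace E G]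

/-- The holomorphic tangent space of a complex manifold at a point and the tangent space of the
underlying real manifold are the same real vector space. -/
def toRealTangent (x : G) : TangentSpace 𝓘(ℂ, E) x ≃ₗ[ℝ] TangentSpace 𝓘(ℝ, E) x :=
  LinearEquiv.refl ℝ E

/-- The complex structure `J` on the tangent space of the underlying real manifold. -/
def cplxStr (x : G) (v : TangentSpace 𝓘(ℝ, E) x) : TangentSpace 𝓘(ℝ, E) x :=
  toRealTangent x (Complex.I • (toRealTangent x).symm v)

variable (E G) in
/-- (Not necessarily continuous) real differential two-forms on the underlying real manifold. -/
abbrev TwoForm : Type _ := ∀ x : G, TangentSpace 𝓘(ℝ, E) x [⋀^Fin 2]→L[ℝ] ℝ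

/-- The expression of a two-form in a chart `e`: its pullback under `e.symm`. -/
def formInChart (Ω : TwoForm E G) (e : OpenPartialHomeomorph G E) (y : E) :
    E [⋀^Fin 2]→L[ℝ] ℝ :=
  (Ω (e.symm y)).compContinuousLinearMap (mfderiv 𝓘(ℝ, E) 𝓘(ℝ, E) e.symm y)

/-- `Ω` is a Kähler form on the open set `U` of a complex manifold: a smooth closed real two-form
on `U` which is `J`-invariant and for which `h(v, w) = Ω(Jv, w)` is positive definite. -/
structure IsKahlerFormOn (U : Set G) (Ω : TwoForm E G) : Prop where
  isOpen : IsOpen U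
  smooth : ∀ e ∈ atlas E G, ContDiffOn ℝ ∞ (formInChart Ω e) (e.target ∩ e.symm ⁻¹' U)
  closed : ∀ e ∈ atlas E G, ∀ y ∈ e.target ∩ e.symm ⁻¹' U, extDeriv (formInChart Ω e) y = 0
  invariant : ∀ x ∈ U, ∀ v w : TangentSpace 𝓘(ℝ, E) x,
    Ω x ![cplxStr x v, cplxStr x w] = Ω x ![v, w]
  pos : ∀ x ∈ U, ∀ v : TangentSpace 𝓘(ℝ, E) x, v ≠ 0 → 0 < Ω x ![cplxStr x v, v]

/-- The open set `U` and the form `Ω` on it are invariant under the right translations `x ↦ x * s`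
by the elements `s` of the subgroup `S`. -/
structure IsRightInvariantOn [Group G] (S : Subgroup G) (U : Set G) (Ω : TwoForm E G) : Prop where
  mul_mem : ∀ x ∈ U, ∀ s ∈ S, x * s ∈ U
  pullback : ∀ x ∈ U, ∀ s ∈ S, (Ω (x * s)).compContinuousLinearMap
    (mfderiv 𝓘(ℝ, E) 𝓘(ℝ, E) (fun z : G => z * s) x) = Ω x

end Forms

/-! ### CR-solvmanifolds -/

section CRS

variable {E : Type*} [NormedAddCommGroup E] [NormedSpace ℂ E]
  {G : Type*} [TopologicalSpace G] [ChartedSpace E G] [Group G]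
  {E₀ : Type*} [NormedAddCommGroup E₀] [NormedSpace ℝ E₀]
  {G₀ : Type*} [TopologicalSpace G₀] [ChartedSpace E₀ G₀] [Group G₀]

/-- The Lie algebra `𝔤` of the complex Lie group `G`. -/
abbrev LieAlg (E G : Type*) [NormedAddCommGroup E] [NormedSpace ℂ E] [TopologicalSpace G]
    [ChartedSpace E G] [Group G] : Type _ := GroupLieAlgebra 𝓘(ℂ, E) G

variable (E E₀) in
/-- The differential at the identity of a homomorphism `ι` from a real Lie group to a complex Lie
group. As `ι 1 = 1`, the tangent spaces of `G` at `ι 1` and at `1` are the same copy of `E`. -/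
def diffAtOne (ι : G₀ →* G) : GroupLieAlgebra 𝓘(ℝ, E₀) G₀ →ₗ[ℝ] LieAlg E G :=
  (LinearEquiv.refl ℝ E : TangentSpace 𝓘(ℝ, E) (ι 1) ≃ₗ[ℝ] LieAlg E G).toLinearMap ∘ₗ
    (mfderiv 𝓘(ℝ, E₀) 𝓘(ℝ, E) ι 1).toLinearMap

variable (E E₀) in
/-- The Lie algebra `𝔤₀` of the Lie subgroup `ι : G₀ → G`, as a real subspace of `𝔤`. -/
def subLieAlg (ι : G₀ →* G) : Submodule ℝ (LieAlg E G) := LinearMap.range (diffAtOne E E₀ ι)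

variable (E E₀) in
/-- `𝔪 = 𝔤₀ ∩ i𝔤₀` for the Lie subgroup `ι : G₀ → G`. -/
def crAlg (ι : G₀ →* G) : Submodule ℝ (LieAlg E G) :=
  maxComplex (subLieAlg E E₀ ι)

variable (E E₀) in
/-- `(Γ, G₀, G)` is a CR-solvmanifold. The real Lie subgroup `G₀` of the complex Lie group `G` is
given with its own Lie group structure and its inclusion `ι`, an injective immersion. -/
structure IsCRS [LieGroup 𝓘(ℂ, E) ω G] [LieGroup 𝓘(ℝ, E₀) ∞ G₀]
    (ι : G₀ →* G) (Γ : Subgroup G₀) : Prop where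
  simplyConnected : SimplyConnectedSpace G
  solvable : Group.IsSolvable G
  simplyConnected₀ : SimplyConnectedSpace G₀
  smooth : ContMDiff 𝓘(ℝ, E₀) 𝓘(ℝ, E) ∞ ι
  injective : Function.Injective ι
  immersion : Function.Injective (diffAtOne E E₀ ι)
  discrete : DiscreteTopology Γ
  cocompact : CompactSpace (G₀ ⧸ Γ)
  generic : IsGeneric (subLieAlg E E₀ ι)

variable (E) in
/-- `(Γ, G₀, G)` is locally Kähler: `Y = G₀/Γ` has an open neighbourhood `V` in `X = G/Γ` with a
Kähler form. As `G → G/Γ` is a local biholomorphism whose deck transformations are the right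
translations by `Γ`, a Kähler form on `V` is the same as a right-`Γ`-invariant Kähler form on the
preimage of `V` in `G`. -/
def IsLocallyKahler (ι : G₀ →* G) (Γ : Subgroup G₀) : Prop :=
  ∃ V : Set (G ⧸ Γ.map ι), IsOpen V ∧ (∀ g : G₀, (QuotientGroup.mk (ι g) : G ⧸ Γ.map ι) ∈ V) ∧
    ∃ Ω : TwoForm E G,
      IsKahlerFormOn ((QuotientGroup.mk : G → G ⧸ Γ.map ι) ⁻¹' V) Ω ∧
      IsRightInvariantOn (Γ.map ι) ((QuotientGroup.mk : G → G ⧸ Γ.map ι) ⁻¹' V) Ω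

end CRS

/-- The value `Ω(X, Y)` of a two-form on `G` at the identity on two elements of the Lie algebra. -/
def formAtOne {E : Type*} [NormedAddCommGroup E] [NormedSpace ℂ E]
    {G : Type*} [TopologicalSpace G] [ChartedSpace E G] [Group G]
    (Ω : TwoForm E G) (X Y : LieAlg E G) : ℝ :=
  Ω 1 ![toRealTangent 1 X, toRealTangent 1 Y]

end CRSolv

end

/-! Both parts are linear algebra once there is a J-invariant, positive real two-form w on 𝔤
satisfying w([x,y],z) + w([y,z],x) + w([z,x],y) = 0 on 𝔤₀ (`IsKahlerOn`). Since 𝔤 = 𝔤₀ + i𝔤₀, 𝔪 is a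
complex ideal of 𝔤. For central x in 𝔪 two terms of the identity vanish, leaving w(x,[𝔤₀,𝔪]) = 0,
which extends to [𝔤,𝔪]. Conversely, if x in 𝔪 satisfies w(x,[𝔤,𝔪]) = 0, then so does ix, and the
middle term vanishes for y in 𝔤₀, z in 𝔪. Comparing the pairs (x,y) and (ix,iy) gives [x,𝔪] = 0;
feeding this back gives [x,𝔤₀] = 0, so x is central (`mem_center_of_forall`). If the center is zero,
the orthogonal complement of [𝔤,𝔪] in 𝔪 for the metric w(i·,·) is therefore zero (`bracketSpan_eq`).

To obtain w, a Kähler form is evaluated on right-invariant vector fields. Closedness becomes a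
cyclic sum of derivatives of the coefficients plus the algebraic cyclic sum
(`IsKahlerFormOn.closed_coeff`). For a right-G₀-invariant form the coefficients are constant along
G₀, so the value at the identity serves as w. For a form that is only right-Γ-invariant, the
coefficients descend to the compact space G₀/Γ. The solvable group G₀ acts there by left
translations and has an invariant mean, by Markov–Kakutani. Right-invariant fields generate left
translations, so the mean kills the derivative terms, while strict positivity survives by
compactness; the averaged coefficients serve as w (`IsKahlerFormOn.exists_isKahlerOn`).

The bracket on 𝔤 is defined by left-invariant fields over ℂ, the computations use right-invariant
fields over ℝ. Both are compared with the antisymmetrized mixed second derivative of the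
multiplication in a chart (`mulBracket`, `lie_eq_localBracket`). -/

noncomputable section

namespace CRSolv

/-! ### Algebra of a Kähler form on 𝔤 that is closed along 𝔤₀ -/

section LieAlg

variable {L : Type*} [LieRing L] [LieAlgebra ℂ L] {g₀ : Submodule ℝ L}

lemma mem_maxComplex {x : L} : x ∈ maxComplex g₀ ↔ x ∈ g₀ ∧ Complex.I • x ∈ g₀ := by
  refine and_congr_right fun hx => ?_
  simp only [SetLike.mem_coe, Submodule.mem_map, mulI, LinearMap.coe_restrictScalars,
    LinearMap.smul_apply, LinearMap.id_apply]
  constructor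
  · rintro ⟨y, hy, rfl⟩
    rw [smul_smul, Complex.I_mul_I, neg_one_smul]
    exact neg_mem hy
  · intro h
    exact ⟨-(Complex.I • x), neg_mem h, by
      rw [smul_neg, smul_smul, Complex.I_mul_I, neg_one_smul, neg_neg]⟩

lemma I_smul_mem_maxComplex {x : L} (hx : x ∈ maxComplex g₀) : Complex.I • x ∈ maxComplex g₀ := by
  rw [mem_maxComplex] at hx ⊢
  refine ⟨hx.2, ?_⟩
  rw [smul_smul, Complex.I_mul_I, neg_one_smul]
  exact neg_mem hx.1

lemma IsGeneric.exists_add_I_smul (h : IsGeneric g₀) (x : L) :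
    ∃ a ∈ g₀, ∃ b ∈ g₀, x = a + Complex.I • b := by
  have hx : x ∈ g₀ ⊔ g₀.map (mulI L) := by rw [h]; trivial
  obtain ⟨a, ha, _, ⟨b, hb, rfl⟩, rfl⟩ := Submodule.mem_sup.1 hx
  exact ⟨a, ha, b, hb, rfl⟩

lemma lie_mem_maxComplex_of_mem (hg : ∀ x ∈ g₀, ∀ y ∈ g₀, ⁅x, y⁆ ∈ g₀) {x y : L} (hx : x ∈ g₀)
    (hy : y ∈ maxComplex g₀) : ⁅x, y⁆ ∈ maxComplex g₀ := by
  rw [mem_maxComplex] at hy ⊢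
  exact ⟨hg x hx y hy.1, by rw [← lie_smul]; exact hg x hx _ hy.2⟩

lemma lie_mem_maxComplex (hg : ∀ x ∈ g₀, ∀ y ∈ g₀, ⁅x, y⁆ ∈ g₀) (hgen : IsGeneric g₀) (x : L)
    {y : L} (hy : y ∈ maxComplex g₀) : ⁅x, y⁆ ∈ maxComplex g₀ := by
  obtain ⟨a, ha, b, hb, rfl⟩ := hgen.exists_add_I_smul x
  rw [add_lie, smul_lie]
  exact add_mem (lie_mem_maxComplex_of_mem hg ha hy)
    (I_smul_mem_maxComplex (lie_mem_maxComplex_of_mem hg hb hy))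

lemma bracketSpan_le (hg : ∀ x ∈ g₀, ∀ y ∈ g₀, ⁅x, y⁆ ∈ g₀) (hgen : IsGeneric g₀) :
    bracketSpan (maxComplex g₀) ≤ maxComplex g₀ := by
  refine Submodule.span_le.2 ?_
  rintro _ ⟨x, y, hy, rfl⟩
  exact lie_mem_maxComplex hg hgen x hy

lemma lie_mem_bracketSpan (x : L) {y : L} (hy : y ∈ maxComplex g₀) :
    ⁅x, y⁆ ∈ bracketSpan (maxComplex g₀) :=
  Submodule.subset_span ⟨x, y, hy, rfl⟩

lemma I_smul_mem_bracketSpan {w : L} (hw : w ∈ bracketSpan (maxComplex g₀)) :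
    Complex.I • w ∈ bracketSpan (maxComplex g₀) := by
  induction hw using Submodule.span_induction with
  | mem w h =>
    obtain ⟨x, y, hy, rfl⟩ := h
    rw [← lie_smul]
    exact lie_mem_bracketSpan x (I_smul_mem_maxComplex hy)
  | zero => rw [smul_zero]; exact zero_mem _
  | add a b _ _ ha hb => rw [smul_add]; exact add_mem ha hb
  | smul r a _ ha => rw [smul_comm]; exact Submodule.smul_mem _ r ha

/-- A real two-form on a complex Lie algebra which is `J`-invariant, positive definite, and closed
on the real subspace `g₀`. -/
structure IsKahlerOn (g₀ : Submodule ℝ L) (w : L →ₗ[ℝ] L →ₗ[ℝ] ℝ) : Prop where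
  alt : ∀ x, w x x = 0
  invariant : ∀ x y, w (Complex.I • x) (Complex.I • y) = w x y
  pos : ∀ x, x ≠ 0 → 0 < w (Complex.I • x) x
  closed : ∀ x ∈ g₀, ∀ y ∈ g₀, ∀ z ∈ g₀, w ⁅x, y⁆ z + w ⁅y, z⁆ x + w ⁅z, x⁆ y = 0

namespace IsKahlerOn

variable {w : L →ₗ[ℝ] L →ₗ[ℝ] ℝ}

lemma swap (h : IsKahlerOn g₀ w) (x y : L) : w x y = - w y x := by
  have := h.alt (x + y)
  simp only [map_add, LinearMap.add_apply, h.alt] at this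
  linarith

lemma apply_I_left (h : IsKahlerOn g₀ w) (x y : L) : w (Complex.I • x) y = - w x (Complex.I • y) := by
  rw [← h.invariant, smul_smul, Complex.I_mul_I, neg_one_smul, map_neg, LinearMap.neg_apply]

lemma eq_zero_of_forall_mem (h : IsKahlerOn g₀ w) {x : L} (hx : x ∈ maxComplex g₀)
    (h0 : ∀ z ∈ maxComplex g₀, w z x = 0) : x = 0 := by
  by_contra hne
  exact (h.pos x hne).ne' (h0 _ (I_smul_mem_maxComplex hx))

/-- Centrality removes two terms of the cocycle identity on 𝔤₀. General y = a + ib is reached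
through [a + ib, z] = [a, z] + [b, iz], where iz stays in 𝔪. -/
lemma apply_bracketSpan_eq_zero (h : IsKahlerOn g₀ w) (hgen : IsGeneric g₀) {x : L}
    (hc : x ∈ LieAlgebra.center ℂ L) (hx : x ∈ maxComplex g₀) :
    ∀ u ∈ bracketSpan (maxComplex g₀), w x u = 0 := by
  have hc' : ∀ y : L, ⁅y, x⁆ = 0 := (LieModule.mem_maxTrivSubmodule _ _ _ x).1 hc
  have key : ∀ y ∈ g₀, ∀ z ∈ maxComplex g₀, w x ⁅y, z⁆ = 0 := by
    intro y hy z hz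
    have := h.closed x (mem_maxComplex.1 hx).1 y hy z (mem_maxComplex.1 hz).1
    rw [← lie_skew, hc', hc', neg_zero, map_zero, LinearMap.zero_apply, LinearMap.zero_apply,
      zero_add, add_zero] at this
    rw [h.swap, this, neg_zero]
  intro u hu
  induction hu using Submodule.span_induction with
  | mem u hu =>
    obtain ⟨y, z, hz, rfl⟩ := hu
    obtain ⟨a, ha, b, hb, rfl⟩ := hgen.exists_add_I_smul y
    rw [add_lie, smul_lie, ← lie_smul, map_add, key a ha z hz,
      key b hb _ (I_smul_mem_maxComplex hz), add_zero]
  | zero => rw [map_zero]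
  | add a b _ _ ha hb => rw [map_add, ha, hb, add_zero]
  | smul r a _ ha => rw [map_smul, ha, smul_zero]

lemma mem_center_of_forall (h : IsKahlerOn g₀ w) (hg : ∀ x ∈ g₀, ∀ y ∈ g₀, ⁅x, y⁆ ∈ g₀)
    (hgen : IsGeneric g₀) {x : L} (hx : x ∈ maxComplex g₀)
    (h0 : ∀ u ∈ bracketSpan (maxComplex g₀), w x u = 0) : x ∈ LieAlgebra.center ℂ L := by
  have mem {z : L} (hz : z ∈ maxComplex g₀) : z ∈ g₀ := (mem_maxComplex.1 hz).1
  -- The third cocycle term pairs v with [y, z], which lies in [𝔤, 𝔪].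
  have skew {v : L} (hv : v ∈ maxComplex g₀)
      (hv0 : ∀ u ∈ bracketSpan (maxComplex g₀), w v u = 0) {y : L} (hy : y ∈ g₀) {z : L}
      (hz : z ∈ maxComplex g₀) : w ⁅v, y⁆ z + w ⁅z, v⁆ y = 0 := by
    have := h.closed v (mem hv) y hy z (mem hz)
    rwa [h.swap ⁅y, z⁆ v, hv0 _ (lie_mem_bracketSpan y hz), neg_zero, add_zero] at this
  have hIx0 : ∀ u ∈ bracketSpan (maxComplex g₀), w (Complex.I • x) u = 0 := fun u hu => by
    rw [h.apply_I_left, h0 _ (I_smul_mem_bracketSpan hu), neg_zero]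
  have ad_zero : ∀ y ∈ maxComplex g₀, ⁅x, y⁆ = 0 := by
    intro y hy
    refine h.eq_zero_of_forall_mem (lie_mem_maxComplex hg hgen x hy) fun z hz => ?_
    have h1 := skew hx h0 (mem (I_smul_mem_maxComplex hy)) hz
    have h2 := skew (I_smul_mem_maxComplex hx) hIx0 (mem hy) hz
    rw [lie_smul, h.swap ⁅z, x⁆, h.apply_I_left y] at h1
    rw [smul_lie, lie_smul, h.apply_I_left ⁅z, x⁆, h.swap ⁅z, x⁆ (Complex.I • y),
      h.apply_I_left y] at h2
    have h3 : w (Complex.I • ⁅x, y⁆) z = 0 := by linarith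
    -- Passing from (x, y) to (ix, iy) flips the sign of w([x,y], z) and, by J-invariance, keeps
    -- w([z,x], y). Together the two relations force w([x,y], z) = 0.
    have h4 := skew hx h0 (mem hy) hz
    have h5 := skew (I_smul_mem_maxComplex hx) hIx0 (mem (I_smul_mem_maxComplex hy)) hz
    rw [smul_lie, lie_smul, lie_smul, h.invariant, smul_smul, Complex.I_mul_I, neg_one_smul,
      map_neg, LinearMap.neg_apply] at h5
    rw [h.swap]
    linarith
  -- Now [z, x] = 0 for z in 𝔪, so `skew` leaves only w([x,y], z), and [x, y] lies in the ideal 𝔪,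
  -- where w is nondegenerate.
  have ad_zero' : ∀ y ∈ g₀, ⁅x, y⁆ = 0 := by
    intro y hy
    have hxy : ⁅x, y⁆ ∈ maxComplex g₀ := by
      rw [← lie_skew]; exact neg_mem (lie_mem_maxComplex hg hgen y hx)
    refine h.eq_zero_of_forall_mem hxy fun z hz => ?_
    have := skew hx h0 hy hz
    rw [← lie_skew z x, ad_zero z hz, neg_zero, map_zero, LinearMap.zero_apply, add_zero] at this
    rw [h.swap, this, neg_zero]
  refine (LieModule.mem_maxTrivSubmodule _ _ _ x).2 fun y => ?_
  obtain ⟨a, ha, b, hb, rfl⟩ := hgen.exists_add_I_smul y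
  rw [← lie_skew, lie_add, lie_smul, ad_zero' a ha, ad_zero' b hb, smul_zero, add_zero, neg_zero]

theorem center_inter_maxComplex (h : IsKahlerOn g₀ w) (hg : ∀ x ∈ g₀, ∀ y ∈ g₀, ⁅x, y⁆ ∈ g₀)
    (hgen : IsGeneric g₀) :
    {x : L | x ∈ LieAlgebra.center ℂ L ∧ x ∈ maxComplex g₀} =
      {x : L | x ∈ maxComplex g₀ ∧ ∀ u ∈ bracketSpan (maxComplex g₀), w x u = 0} := by
  ext x
  exact ⟨fun ⟨hc, hx⟩ => ⟨hx, h.apply_bracketSpan_eq_zero hgen hc hx⟩,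
    fun ⟨hx, h0⟩ => ⟨h.mem_center_of_forall hg hgen hx h0, hx⟩⟩

/-- The metric w(i·,·) is definite, so 𝔤 splits as [𝔤,𝔪] plus its orthogonal complement. The
complementary part t of an element of 𝔪 lies in 𝔪 and satisfies w(it, [𝔤,𝔪]) = 0, so it is central
and hence zero. -/
theorem bracketSpan_eq [FiniteDimensional ℝ L] (h : IsKahlerOn g₀ w)
    (hg : ∀ x ∈ g₀, ∀ y ∈ g₀, ⁅x, y⁆ ∈ g₀)
    (hgen : IsGeneric g₀) (hz : LieAlgebra.center ℂ L = ⊥) :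
    bracketSpan (maxComplex g₀) = maxComplex g₀ := by
  refine le_antisymm (bracketSpan_le hg hgen) fun x hx => ?_
  set S := bracketSpan (maxComplex g₀)
  let b : LinearMap.BilinForm ℝ L := w ∘ₗ mulI L
  have hb (x y : L) : b x y = w (Complex.I • x) y := rfl
  have hsymm : b.IsRefl := fun x y hxy => by
    rw [hb] at hxy ⊢
    rw [h.apply_I_left, ← h.swap, hxy]
  have hnd : (b.restrict S).Nondegenerate := by
    rw [LinearMap.BilinForm.Nondegenerate, LinearMap.IsRefl.nondegenerate_iff_separatingLeft]
    · intro y hy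
      by_contra hne
      exact (h.pos y (by simpa using hne)).ne' (hy y)
    · exact fun a c => hsymm a c
  have hc := LinearMap.BilinForm.isCompl_orthogonal_of_restrict_nondegenerate hsymm hnd
  have hxt : x ∈ S ⊔ b.orthogonal S := by rw [hc.sup_eq_top]; trivial
  obtain ⟨s, hs, t, ht, rfl⟩ := Submodule.mem_sup.1 hxt
  have htm : t ∈ maxComplex g₀ := by
    simpa using sub_mem hx (bracketSpan_le hg hgen hs)
  have hIt : Complex.I • t ∈ LieAlgebra.center ℂ L := by
    refine h.mem_center_of_forall hg hgen (I_smul_mem_maxComplex htm) fun u hu => ?_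
    exact hsymm _ _ (ht u hu)
  rw [hz] at hIt
  have ht0 : t = 0 := (smul_eq_zero.1 ((LieSubmodule.mem_bot _).1 hIt)).resolve_left Complex.I_ne_zero
  rw [ht0, add_zero]
  exact hs

end IsKahlerOn

end LieAlg

/-! ### Markov–Kakutani fixed points, for commuting maps and for solvable groups -/

section FixedPoint

open Filter Set
open scoped commutatorElement

lemma isCompact_inter_fixedPoints {V : Type*} [AddCommGroup V] [Module ℝ V] [TopologicalSpace V]
    [T2Space V] {K : Set V} (hK : IsCompact K) (T : V →L[ℝ] V) :
    IsCompact (K ∩ {x | T x = x}) :=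
  hK.inter_right (isClosed_eq T.continuous continuous_id)

lemma convex_fixedPoints {V : Type*} [AddCommGroup V] [Module ℝ V] [TopologicalSpace V]
    (T : V →L[ℝ] V) : Convex ℝ {x | T x = x} := by
  intro x hx y hy a b _ _ _
  simp only [mem_ofPred_eq] at hx hy ⊢
  rw [map_add, map_smul, map_smul, hx, hy]

variable {V : Type*} [AddCommGroup V] [Module ℝ V] [TopologicalSpace V] [IsTopologicalAddGroup V]
  [ContinuousSMul ℝ V] [T2Space V]

/-- The averages u n of the orbit of a point satisfy T(u n) - u n = (T^(n+1) x₀ - x₀)/(n+1), which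
tends to 0 because K is bounded. Any cluster point of u is fixed. -/
lemma exists_fixedPoint_of_mapsTo {K : Set V} (hK : IsCompact K) (hconv : Convex ℝ K)
    (hne : K.Nonempty) (T : V →L[ℝ] V) (hT : MapsTo T K K) : ∃ x ∈ K, T x = x := by
  obtain ⟨x₀, hx₀⟩ := hne
  have hiter (n : ℕ) : T^[n] x₀ ∈ K := (hT.iterate n) hx₀
  let u : ℕ → V := fun n => (n + 1 : ℝ)⁻¹ • ∑ k ∈ Finset.range (n + 1), T^[k] x₀
  have hu (n : ℕ) : u n ∈ K := by
    simp only [u, Finset.smul_sum]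
    refine hconv.sum_mem (fun _ _ => by positivity) ?_ fun k _ => hiter k
    rw [Finset.sum_const, Finset.card_range, nsmul_eq_mul]
    push_cast
    exact mul_inv_cancel₀ (by positivity)
  have hTu (n : ℕ) : T (u n) - u n = (n + 1 : ℝ)⁻¹ • (T^[n + 1] x₀ - x₀) := by
    simp only [u, map_smul, map_sum, ← smul_sub, ← Finset.sum_sub_distrib]
    congr 1
    simp_rw [← Function.iterate_succ_apply' T]
    exact Finset.sum_range_sub (fun k => T^[k] x₀) (n + 1)
  have hinv : Tendsto (fun n : ℕ => (n + 1 : ℝ)⁻¹) atTop (𝓝 0) := by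
    simpa using tendsto_one_div_add_atTop_nhds_zero_nat (𝕜 := ℝ)
  have hlim : Tendsto (fun n => T (u n) - u n) atTop (𝓝 0) := by
    simp_rw [hTu, smul_sub]
    have h1 : Tendsto (fun n : ℕ => (n + 1 : ℝ)⁻¹ • T^[n + 1] x₀) atTop (𝓝 0) :=
      (hK.isVonNBounded ℝ).smul_tendsto_zero (Eventually.of_forall fun n => hiter (n + 1)) hinv
    simpa using h1.sub (hinv.smul_const x₀)
  obtain ⟨y, hy, hcl⟩ := hK.exists_mapClusterPt (f := atTop) (u := u)
    (tendsto_principal.2 (Eventually.of_forall hu))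
  refine ⟨y, hy, sub_eq_zero.1 ?_⟩
  have hcl' : MapClusterPt (T y - y) atTop (fun n => T (u n) - u n) :=
    hcl.continuousAt_comp (f := fun v => T v - v)
      (T.continuous.sub continuous_id).continuousAt
  exact eq_of_nhds_neBot (NeBot.mono hcl' (inf_le_inf_left _ hlim))

/-- The fixed points of one map in K form a smaller compact convex set, preserved by the maps that
commute with it. Commutation is required only on K because in the solvable case the operators
commute only on the points fixed by the next derived subgroup. -/
lemma exists_common_fixedPoint_finset (s : Finset (V →L[ℝ] V)) :
    ∀ {K : Set V}, IsCompact K → Convex ℝ K → K.Nonempty → (∀ T ∈ s, MapsTo T K K) →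
      (∀ T ∈ s, ∀ T' ∈ s, ∀ x ∈ K, T (T' x) = T' (T x)) → ∃ x ∈ K, ∀ T ∈ s, T x = x := by
  classical
  induction s using Finset.induction_on with
  | empty => intro K _ _ hne _ _; exact ⟨hne.some, hne.some_mem, by simp⟩
  | insert T s _ ih =>
    intro K hK hconv hne hmaps hcomm
    obtain ⟨x, hx, hTx⟩ := exists_fixedPoint_of_mapsTo hK hconv hne T (hmaps T (by simp))
    obtain ⟨y, ⟨hyK, hTy⟩, hy⟩ := ih (isCompact_inter_fixedPoints hK T)
      (hconv.inter (convex_fixedPoints T)) ⟨x, hx, hTx⟩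
      (fun S hS z hz => ⟨hmaps S (by simp [hS]) hz.1, by
        rw [mem_ofPred_eq, hcomm T (by simp) S (by simp [hS]) z hz.1, hz.2]⟩)
      (fun S hS S' hS' z hz => hcomm S (by simp [hS]) S' (by simp [hS']) z hz.1)
    refine ⟨y, hyK, fun S hS => ?_⟩
    rcases Finset.mem_insert.1 hS with rfl | hS
    · exact hTy
    · exact hy S hS

/-- The Markov–Kakutani fixed point theorem. -/
theorem exists_common_fixedPoint {K : Set V} (hK : IsCompact K) (hconv : Convex ℝ K)
    (hne : K.Nonempty) (S : Set (V →L[ℝ] V)) (hmaps : ∀ T ∈ S, MapsTo T K K)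
    (hcomm : ∀ T ∈ S, ∀ T' ∈ S, ∀ x ∈ K, T (T' x) = T' (T x)) :
    ∃ x ∈ K, ∀ T ∈ S, T x = x := by
  classical
  have := hK.inter_iInter_nonempty (fun T : S => {x | (T : V →L[ℝ] V) x = x})
    (fun T => isClosed_eq T.1.continuous continuous_id) (fun s => by
      obtain ⟨x, hx, hfix⟩ := exists_common_fixedPoint_finset (s.image Subtype.val) hK hconv hne
        (by simp only [Finset.mem_image]; rintro _ ⟨T, _, rfl⟩; exact hmaps T T.2)
        (by
          simp only [Finset.mem_image]
          rintro _ ⟨T, _, rfl⟩ _ ⟨T', _, rfl⟩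
          exact hcomm T T.2 T' T'.2)
      exact ⟨x, hx, mem_iInter₂.2 fun T hT => hfix T (Finset.mem_image_of_mem _ hT)⟩)
  obtain ⟨x, hx, hfix⟩ := this
  exact ⟨x, hx, fun T hT => mem_iInter.1 hfix ⟨T, hT⟩⟩

/-- A solvable group of continuous linear maps which preserves a nonempty compact convex set has a
fixed point in it. -/
theorem exists_fixedPoint_of_isSolvable {A : Type*} [Group A] (hA : Group.IsSolvable A)
    (ρ : A →* (V →L[ℝ] V)) {K : Set V} (hK : IsCompact K) (hconv : Convex ℝ K)
    (hne : K.Nonempty) (hmaps : ∀ a, MapsTo (ρ a) K K) : ∃ x ∈ K, ∀ a, ρ a x = x := by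
  have hmul (a b : A) (x : V) : ρ (a * b) x = ρ a (ρ b x) := by
    rw [map_mul, mul_apply_eq_comp]
  -- Descend along the derived series: the last term is trivial, so its F is K, and F 0 is the set
  -- of common fixed points. On F (n + 1) the n-th derived subgroup acts through commuting
  -- operators.
  let F : ℕ → Set V := fun n => K ∩ ⋂ a ∈ derivedSeries A n, {x | ρ a x = x}
  have hF {n : ℕ} {x : V} : x ∈ F n ↔ x ∈ K ∧ ∀ a ∈ derivedSeries A n, ρ a x = x := by
    simp [F]
  have step (n : ℕ) (h : (F (n + 1)).Nonempty) : (F n).Nonempty := by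
    have hcomp : IsCompact (F (n + 1)) := hK.inter_right <| isClosed_biInter fun a _ =>
      isClosed_eq (ρ a).continuous continuous_id
    have hcv : Convex ℝ (F (n + 1)) := hconv.inter <| convex_iInter₂ fun a _ =>
      convex_fixedPoints (ρ a)
    obtain ⟨x, hx, hfix⟩ := exists_common_fixedPoint hcomp hcv h (ρ '' derivedSeries A n)
      (by
        rintro _ ⟨a, _, rfl⟩ x hx
        rw [hF] at hx ⊢
        refine ⟨hmaps a hx.1, fun b hb => ?_⟩
        -- Normality of the derived subgroup makes F (n + 1) stable.
        have hc : a⁻¹ * b * a ∈ derivedSeries A (n + 1) := by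
          simpa using (derivedSeries_normal A (n + 1)).conj_mem b hb a⁻¹
        rw [← hmul, show b * a = a * (a⁻¹ * b * a) by group, hmul, hx.2 _ hc])
      (by
        rintro _ ⟨a, ha, rfl⟩ _ ⟨b, hb, rfl⟩ x hx
        have hc : ⁅a⁻¹, b⁻¹⁆ ∈ derivedSeries A (n + 1) :=
          Subgroup.commutator_mem_commutator (inv_mem ha) (inv_mem hb)
        rw [← hmul, ← hmul, show a * b = b * a * ⁅a⁻¹, b⁻¹⁆ by
          rw [commutatorElement_def]; group, hmul, (hF.1 hx).2 _ hc])
    exact ⟨x, hF.2 ⟨(hF.1 hx).1, fun a ha => hfix _ ⟨a, ha, rfl⟩⟩⟩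
  obtain ⟨n, hn⟩ := hA.solvable
  have hFn : (F n).Nonempty := by
    obtain ⟨x, hx⟩ := hne
    refine ⟨x, hF.2 ⟨hx, fun a ha => ?_⟩⟩
    rw [hn, Subgroup.mem_bot] at ha
    rw [ha, map_one, one_apply_eq_self]
  have hF0 : (F 0).Nonempty := by
    clear hn
    induction n with
    | zero => exact hFn
    | succ n ih => exact ih (step n hFn)
  obtain ⟨x, hx⟩ := hF0
  exact ⟨x, (hF.1 hx).1, fun a => (hF.1 hx).2 a (by simp)⟩

end FixedPoint

/-! ### Invariant means on compact spaces -/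

section Mean

variable {A Y : Type*} [Group A] [TopologicalSpace Y] [CompactSpace Y] [Nonempty Y]
  [MulAction A Y] [ContinuousConstSMul A Y]

/-- A solvable group acting on a compact space has an invariant mean. -/
theorem exists_invariant_mean (hA : Group.IsSolvable A) :
    ∃ M : C(Y, ℝ) →ₗ[ℝ] ℝ, (∀ f : C(Y, ℝ), (∀ y, 0 ≤ f y) → 0 ≤ M f) ∧ M 1 = 1 ∧
      ∀ (a : A) (f f' : C(Y, ℝ)), (∀ y, f' y = f (a • y)) → M f' = M f := by
  let σ (a : A) (f : C(Y, ℝ)) : C(Y, ℝ) := ⟨fun y => f (a • y), by fun_prop⟩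
  let ρ : A →* ((C(Y, ℝ) → ℝ) →L[ℝ] (C(Y, ℝ) → ℝ)) :=
    { toFun := fun a => ContinuousLinearMap.pi fun f => ContinuousLinearMap.proj (σ a f)
      map_one' := by
        ext M f
        have : σ 1 f = f := by ext y; simp [σ]
        simp [this]
      map_mul' := fun a b => by
        ext M f
        simp [σ, mul_smul] }
  have hρ (a : A) (M : C(Y, ℝ) → ℝ) (f : C(Y, ℝ)) : ρ a M f = M (σ a f) := rfl
  -- The normalized positive functionals, inside the product of lines indexed by C(Y, ℝ). The bound
  -- |M f| ≤ ‖f‖ puts K in a product of intervals, so Tychonoff gives compactness; evaluation at a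
  -- point shows K is nonempty.
  let K : Set (C(Y, ℝ) → ℝ) := {M | (∀ f g, M (f + g) = M f + M g) ∧
    (∀ (c : ℝ) f, M (c • f) = c * M f) ∧ (∀ f : C(Y, ℝ), (∀ y, 0 ≤ f y) → 0 ≤ M f) ∧ M 1 = 1}
  have hclosed : IsClosed K := by
    simp only [K, Set.ofPred_and, Set.ofPred_forall]
    refine IsClosed.inter ?_ (IsClosed.inter ?_ (IsClosed.inter ?_ ?_))
    · exact isClosed_iInter fun f => isClosed_iInter fun g => isClosed_eq (by fun_prop) (by fun_prop)
    · exact isClosed_iInter fun f => isClosed_iInter fun g => isClosed_eq (by fun_prop) (by fun_prop)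
    · exact isClosed_iInter fun f => isClosed_iInter fun _ => isClosed_le (by fun_prop) (by fun_prop)
    · exact isClosed_eq (by fun_prop) (by fun_prop)
  have hbound : K ⊆ Set.pi Set.univ fun f => Set.Icc (-‖f‖) ‖f‖ := by
    rintro M ⟨hadd, hsmul, hpos, hone⟩ f -
    have h1 := hpos (‖f‖ • 1 + f) fun y => by
      have := (abs_le.1 (f.norm_coe_le_norm y)).1
      simp; linarith
    have h2 := hpos (‖f‖ • 1 + (-1 : ℝ) • f) fun y => by
      have := (abs_le.1 (f.norm_coe_le_norm y)).2
      simp; linarith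
    rw [hadd, hsmul, hone] at h1 h2
    rw [hsmul] at h2
    constructor <;> linarith
  have hcomp : IsCompact K :=
    (isCompact_univ_pi fun f => isCompact_Icc).of_isClosed_subset hclosed hbound
  have hconv : Convex ℝ K := by
    rintro M ⟨h1, h2, h3, h4⟩ M' ⟨h1', h2', h3', h4'⟩ a b ha hb hab
    refine ⟨fun f g => ?_, fun c f => ?_, fun f hf => ?_, ?_⟩ <;>
      simp only [Pi.add_apply, Pi.smul_apply, smul_eq_mul]
    · rw [h1, h1']; ring
    · rw [h2, h2']; ring
    · exact add_nonneg (mul_nonneg ha (h3 f hf)) (mul_nonneg hb (h3' f hf))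
    · rw [h4, h4']; linarith
  have hne : K.Nonempty := by
    obtain ⟨y⟩ := ‹Nonempty Y›
    exact ⟨fun f => f y, fun _ _ => rfl, fun _ _ => rfl, fun f hf => hf y, rfl⟩
  obtain ⟨M, ⟨h1, h2, h3, h4⟩, hfix⟩ := exists_fixedPoint_of_isSolvable hA ρ hcomp hconv hne (by
    rintro a M ⟨h1, h2, h3, h4⟩
    exact ⟨fun f g => h1 (σ a f) (σ a g), fun c f => h2 c (σ a f),
      fun f hf => h3 (σ a f) fun y => hf _, h4⟩)
  refine ⟨⟨⟨M, h1⟩, h2⟩, h3, h4, fun a f f' hf => ?_⟩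
  have : f' = σ a f := ContinuousMap.ext hf
  rw [this]
  exact congrFun (hfix a) f

end Mean

/-! ### Brackets of germs of group laws through mixed second derivatives -/

section MixedDerivative

variable {A B C D : Type*} [NormedAddCommGroup A] [NormedSpace ℝ A] [NormedAddCommGroup B]
  [NormedSpace ℝ B] [NormedAddCommGroup C] [NormedSpace ℝ C] [NormedAddCommGroup D]
  [NormedSpace ℝ D]

/-- The mixed second derivative of a function of two variables. -/
def mixedDeriv (f : A × B → C) (p : A × B) (u : A) (v : B) : C :=
  fderiv ℝ (fderiv ℝ f) p (u, 0) (0, v)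

lemma _root_.DifferentiableAt.fderiv_partial_left {f : A × B → C} {x : A} {y : B}
    (hf : DifferentiableAt ℝ f (x, y)) (u : A) :
    fderiv ℝ (fun x' => f (x', y)) x u = fderiv ℝ f (x, y) (u, 0) := by
  have := hf.hasFDerivAt.comp x (hasFDerivAt_prodMk_left (𝕜 := ℝ) x y)
  simpa [Function.comp_def] using congrArg (fun T => T u) this.fderiv

lemma _root_.DifferentiableAt.fderiv_partial_right {f : A × B → C} {x : A} {y : B}
    (hf : DifferentiableAt ℝ f (x, y)) (v : B) :
    fderiv ℝ (fun y' => f (x, y')) y v = fderiv ℝ f (x, y) (0, v) := by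
  have := hf.hasFDerivAt.comp y (hasFDerivAt_prodMk_right (𝕜 := ℝ) x y)
  simpa [Function.comp_def] using congrArg (fun T => T v) this.fderiv

lemma _root_.ContDiffAt.eventually_differentiableAt {f : A → B} {p : A}
    (hf : ContDiffAt ℝ 2 f p) : ∀ᶠ q in 𝓝 p, DifferentiableAt ℝ f q := by
  filter_upwards [hf.eventually (by simp)] with q hq
  exact hq.differentiableAt (by simp)

lemma _root_.ContDiffAt.differentiableAt_fderiv {f : A → B} {p : A} (hf : ContDiffAt ℝ 2 f p) :
    DifferentiableAt ℝ (fderiv ℝ f) p :=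
  (hf.fderiv_right (m := 1) (by norm_num)).differentiableAt (by simp)

lemma eventually_fderiv_partial_left {f : A × B → C} {x : A} {y : B}
    (hf : ContDiffAt ℝ 2 f (x, y)) (u : A) :
    (fun y' => fderiv ℝ (fun x' => f (x', y')) x u) =ᶠ[𝓝 y] fun y' => fderiv ℝ f (x, y') (u, 0) := by
  have h : Filter.Tendsto (fun y' : B => (x, y')) (𝓝 y) (𝓝 (x, y)) :=
    (Continuous.prodMk_right x).continuousAt
  filter_upwards [h.eventually hf.eventually_differentiableAt] with y' hy'
  exact hy'.fderiv_partial_left u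

lemma eventually_fderiv_partial_right {f : A × B → C} {x : A} {y : B}
    (hf : ContDiffAt ℝ 2 f (x, y)) (v : B) :
    (fun x' => fderiv ℝ (fun y' => f (x', y')) y v) =ᶠ[𝓝 x] fun x' => fderiv ℝ f (x', y) (0, v) := by
  have h : Filter.Tendsto (fun x' : A => (x', y)) (𝓝 x) (𝓝 (x, y)) :=
    (Continuous.prodMk_left y).continuousAt
  filter_upwards [h.eventually hf.eventually_differentiableAt] with x' hx'
  exact hx'.fderiv_partial_right v

lemma fderiv_fderiv_partial_right {f : A × B → C} {x : A} {y : B} (hf : ContDiffAt ℝ 2 f (x, y))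
    (u : A) (v : B) :
    fderiv ℝ (fun x' => fderiv ℝ (fun y' => f (x', y')) y v) x u = mixedDeriv f (x, y) u v := by
  rw [(eventually_fderiv_partial_right hf v).fderiv_eq]
  have h1 : DifferentiableAt ℝ (fun p => fderiv ℝ f p (0, v)) (x, y) :=
    hf.differentiableAt_fderiv.clm_apply (differentiableAt_const _)
  rw [h1.fderiv_partial_left, fderiv_clm_apply hf.differentiableAt_fderiv (differentiableAt_const _)]
  simp [mixedDeriv]

lemma fderiv_fderiv_partial_left {f : A × B → C} {x : A} {y : B} (hf : ContDiffAt ℝ 2 f (x, y))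
    (u : A) (v : B) :
    fderiv ℝ (fun y' => fderiv ℝ (fun x' => f (x', y')) x u) y v = mixedDeriv f (x, y) u v := by
  rw [(eventually_fderiv_partial_left hf u).fderiv_eq]
  have h1 : DifferentiableAt ℝ (fun p => fderiv ℝ f p (u, 0)) (x, y) :=
    hf.differentiableAt_fderiv.clm_apply (differentiableAt_const _)
  rw [h1.fderiv_partial_right, fderiv_clm_apply hf.differentiableAt_fderiv
    (differentiableAt_const _)]
  have hsymm := hf.isSymmSndFDerivAt (by simp [minSmoothness_of_isRCLikeNormedField])
  simpa [mixedDeriv] using hsymm (0, v) (u, 0)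

lemma contDiffAt_fderiv_partial_left {f : A × B → C} {x : A} {y : B}
    (hf : ContDiffAt ℝ ∞ f (x, y)) (u : A) :
    ContDiffAt ℝ ∞ (fun y' => fderiv ℝ (fun x' => f (x', y')) x u) y := by
  refine ContDiffAt.congr_of_eventuallyEq ?_
    (eventually_fderiv_partial_left (hf.of_le ENat.LEInfty.out) u)
  have h1 : ContDiffAt ℝ ∞ (fderiv ℝ f) (x, y) := hf.fderiv_right (by simp)
  exact (h1.comp y (contDiffAt_const.prodMk contDiffAt_id)).clm_apply contDiffAt_const

lemma mixedDeriv_congr {f g : A × B → C} {p : A × B} (h : f =ᶠ[𝓝 p] g) (u : A) (v : B) :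
    mixedDeriv f p u v = mixedDeriv g p u v := by
  rw [mixedDeriv, mixedDeriv, h.fderiv.fderiv_eq]

/-- Each inner map depends on one variable only, so its second derivative never enters the mixed
derivative. -/
lemma mixedDeriv_comp_prodMap {A' B' : Type*} [NormedAddCommGroup A'] [NormedSpace ℝ A']
    [NormedAddCommGroup B'] [NormedSpace ℝ B'] {a : A' × B' → C} {f : A → A'} {g : B → B'}
    {x : A} {y : B} (ha : ContDiffAt ℝ 2 a (f x, g y)) (hf : ContDiffAt ℝ 2 f x)
    (hg : ContDiffAt ℝ 2 g y) (u : A) (v : B) :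
    mixedDeriv (fun p : A × B => a (f p.1, g p.2)) (x, y) u v =
      mixedDeriv a (f x, g y) (fderiv ℝ f x u) (fderiv ℝ g y v) := by
  have hc : ContDiffAt ℝ 2 (fun p : A × B => a (f p.1, g p.2)) (x, y) :=
    ContDiffAt.comp (x, y) (g := a) (f := fun p : A × B => (f p.1, g p.2)) ha
      ((hf.comp (x, y) contDiffAt_fst).prodMk (hg.comp (x, y) contDiffAt_snd))
  rw [← fderiv_fderiv_partial_left hc, ← fderiv_fderiv_partial_left ha]
  have hev : (fun y' => fderiv ℝ (fun x' => a (f x', g y')) x u) =ᶠ[𝓝 y]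
      (fun z => fderiv ℝ (fun x' => a (x', z)) (f x) (fderiv ℝ f x u)) ∘ g := by
    have h : Filter.Tendsto (fun y' : B => (f x, g y')) (𝓝 y) (𝓝 (f x, g y)) :=
      (Continuous.prodMk_right (f x)).continuousAt.tendsto.comp hg.continuousAt
    filter_upwards [h.eventually ha.eventually_differentiableAt] with y' hy'
    have h1 : DifferentiableAt ℝ (fun x' => a (x', g y')) (f x) :=
      DifferentiableAt.comp (f x) (g := a) (f := fun x' => (x', g y')) hy'
        (differentiableAt_id.prodMk (differentiableAt_const _))
    exact congrArg (fun T => T u) (fderiv_comp x h1 (hf.differentiableAt (by simp)))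
  rw [hev.fderiv_eq, fderiv_comp]
  · rfl
  · refine ((eventually_fderiv_partial_left ha _).differentiableAt_iff).2 ?_
    have h2 : DifferentiableAt ℝ (fun p => fderiv ℝ a p (fderiv ℝ f x u, 0)) (f x, g y) :=
      ha.differentiableAt_fderiv.clm_apply (differentiableAt_const _)
    exact h2.comp (g y) ((differentiableAt_const _).prodMk differentiableAt_id)
  · exact hg.differentiableAt (by simp)

/-- The mixed derivative of `b ∘ m`, where `m` is a germ of a group law with unit `x`. -/
lemma mixedDeriv_comp_mul {m : A × A → A} {b : A → C} {x : A} (hm : ContDiffAt ℝ 2 m (x, x))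
    (hb : ContDiffAt ℝ 2 b x) (hl : ∀ᶠ z in 𝓝 x, m (x, z) = z) (hr : ∀ᶠ z in 𝓝 x, m (z, x) = z)
    (u v : A) :
    mixedDeriv (fun p => b (m p)) (x, x) u v =
      fderiv ℝ (fderiv ℝ b) x v u + fderiv ℝ b x (mixedDeriv m (x, x) u v) := by
  have hmx : m (x, x) = x := hl.self_of_nhds
  have hc : ContDiffAt ℝ 2 (fun p => b (m p)) (x, x) :=
    ContDiffAt.comp (x, x) (g := b) (by rwa [hmx]) hm
  rw [← fderiv_fderiv_partial_left hc, ← fderiv_fderiv_partial_left hm]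
  have hev : (fun z => fderiv ℝ (fun x' => b (m (x', z))) x u) =ᶠ[𝓝 x]
      fun z => fderiv ℝ b z (fderiv ℝ (fun x' => m (x', z)) x u) := by
    have h : Filter.Tendsto (fun z : A => (x, z)) (𝓝 x) (𝓝 (x, x)) :=
      (Continuous.prodMk_right x).continuousAt
    filter_upwards [h.eventually hm.eventually_differentiableAt, hl,
      hb.eventually_differentiableAt] with z h1 h2 h3
    have h4 : DifferentiableAt ℝ (fun x' => m (x', z)) x :=
      DifferentiableAt.comp x (g := m) (f := fun x' => (x', z)) h1
        (differentiableAt_id.prodMk (differentiableAt_const _))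
    have h5 := fderiv_comp x (g := b) (f := fun x' => m (x', z)) (by rwa [h2]) h4
    rw [h2] at h5
    exact congrArg (fun T => T u) h5
  have hd : DifferentiableAt ℝ (fun z => fderiv ℝ (fun x' => m (x', z)) x u) x := by
    refine ((eventually_fderiv_partial_left hm _).differentiableAt_iff).2 ?_
    have h2 : DifferentiableAt ℝ (fun p => fderiv ℝ m p (u, 0)) (x, x) :=
      hm.differentiableAt_fderiv.clm_apply (differentiableAt_const _)
    exact h2.comp x ((differentiableAt_const _).prodMk differentiableAt_id)
  have hu : fderiv ℝ (fun x' => m (x', x)) x u = u := by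
    have : (fun x' => m (x', x)) =ᶠ[𝓝 x] id := hr
    rw [this.fderiv_eq, fderiv_id]; rfl
  rw [hev.fderiv_eq, fderiv_clm_apply hb.differentiableAt_fderiv hd]
  simp [hu, add_comm]

/-- The bracket of a germ of a group law. -/
def mulBracket (m : A × A → A) (x : A) (u v : A) : A :=
  mixedDeriv m (x, x) u v - mixedDeriv m (x, x) v u

/-- The differential of a germ of a homomorphism preserves brackets. -/
lemma fderiv_mulBracket {m₀ : A × A → A} {m : B × B → B} {f : A → B} {x : A}
    (hm₀ : ContDiffAt ℝ 2 m₀ (x, x)) (hm : ContDiffAt ℝ 2 m (f x, f x)) (hf : ContDiffAt ℝ 2 f x)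
    (hl : ∀ᶠ z in 𝓝 x, m₀ (x, z) = z) (hr : ∀ᶠ z in 𝓝 x, m₀ (z, x) = z)
    (hhom : ∀ᶠ p in 𝓝 (x, x), f (m₀ p) = m (f p.1, f p.2)) (u v : A) :
    fderiv ℝ f x (mulBracket m₀ x u v) = mulBracket m (f x) (fderiv ℝ f x u) (fderiv ℝ f x v) := by
  -- Differentiate both sides of f(m₀(p, q)) = m(f p, f q). The second derivative of f is symmetric
  -- and cancels on antisymmetrizing.
  have key (u v : A) : mixedDeriv m (f x, f x) (fderiv ℝ f x u) (fderiv ℝ f x v) =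
      fderiv ℝ (fderiv ℝ f) x v u + fderiv ℝ f x (mixedDeriv m₀ (x, x) u v) := by
    rw [← mixedDeriv_comp_prodMap hm hf hf, ← mixedDeriv_comp_mul hm₀ hf hl hr]
    exact (mixedDeriv_congr hhom u v).symm
  have hsymm := hf.isSymmSndFDerivAt (by simp [minSmoothness_of_isRCLikeNormedField])
  rw [mulBracket, mulBracket, map_sub, key, key, hsymm v u]
  abel

/-- The bracket of the infinitesimal generators of a germ of a left action. -/
lemma lieBracket_generator {m : A × A → A} {a : A × B → B} {x : A} {y : B}
    (hm : ContDiffAt ℝ 2 m (x, x)) (ha : ContDiffAt ℝ 2 a (x, y))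
    (hl : ∀ᶠ z in 𝓝 x, m (x, z) = z) (hr : ∀ᶠ z in 𝓝 x, m (z, x) = z) (hay : a (x, y) = y)
    (hact : ∀ᶠ p in 𝓝 (x, x), a (p.1, a (p.2, y)) = a (m p, y)) (u v : A) :
    VectorField.lieBracket ℝ (fun z => fderiv ℝ (fun x' => a (x', z)) x u)
      (fun z => fderiv ℝ (fun x' => a (x', z)) x v) y =
      - fderiv ℝ (fun x' => a (x', y)) x (mulBracket m x u v) := by
  set b : A → B := fun x' => a (x', y)
  have hb : ContDiffAt ℝ 2 b x := ContDiffAt.comp x (g := a) (f := fun x' => (x', y)) ha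
    (contDiffAt_id.prodMk contDiffAt_const)
  have hbx : b x = y := hay
  have ha' : ContDiffAt ℝ 2 a (id x, b x) := by rwa [hbx]
  -- Mixed derivative of the action law a(p, a(q, y)) = a(m(p, q), y), with b the orbit map of y.
  -- The bracket of vector fields takes these terms in the opposite order, whence the minus sign.
  have key (u v : A) : mixedDeriv a (x, y) u (fderiv ℝ b x v) =
      fderiv ℝ (fderiv ℝ b) x v u + fderiv ℝ b x (mixedDeriv m (x, x) u v) := by
    rw [← mixedDeriv_comp_mul hm hb hl hr]
    have h := mixedDeriv_comp_prodMap (f := id) (g := b) ha' contDiffAt_id hb u v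
    rw [fderiv_id, hbx] at h
    exact h.symm.trans (mixedDeriv_congr hact u v)
  have hsymm := hb.isSymmSndFDerivAt (by simp [minSmoothness_of_isRCLikeNormedField])
  rw [VectorField.lieBracket, fderiv_fderiv_partial_left ha, fderiv_fderiv_partial_left ha, key, key,
    hsymm v u, mulBracket, map_sub]
  abel

end MixedDerivative

/-! ### From complex to real manifolds and derivatives -/

section RealStructure

variable {E : Type*} [NormedAddCommGroup E] [NormedSpace ℂ E]
  {F : Type*} [NormedAddCommGroup F] [NormedSpace ℂ F]
  {M : Type*} [TopologicalSpace M] [ChartedSpace E M]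
  {N : Type*} [TopologicalSpace N] [ChartedSpace F N]

/-- A complex manifold is a real manifold. -/
lemma isManifold_real {n : WithTop ℕ∞} [IsManifold 𝓘(ℂ, E) n M] : IsManifold 𝓘(ℝ, E) n M := by
  refine isManifold_of_contDiffOn _ _ _ fun e e' he he' => ?_
  have h := contDiffGroupoid n 𝓘(ℂ, E) |>.compatible he he'
  rw [contDiffGroupoid, mem_groupoid_of_pregroupoid] at h
  exact ContDiffOn.restrict_scalars ℝ h.1

lemma _root_.ContMDiffAt.restrict_scalars_real {n : WithTop ℕ∞} {f : M → N} {x : M}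
    (hf : ContMDiffAt 𝓘(ℂ, E) 𝓘(ℂ, F) n f x) : ContMDiffAt 𝓘(ℝ, E) 𝓘(ℝ, F) n f x := by
  rw [contMDiffAt_iff] at hf ⊢
  exact ⟨hf.1, ContDiffWithinAt.restrict_scalars ℝ hf.2⟩

/-- A complex Lie group is a real Lie group. -/
lemma lieGroup_real [Group M] {n : WithTop ℕ∞} [LieGroup 𝓘(ℂ, E) n M] : LieGroup 𝓘(ℝ, E) n M :=
  { isManifold_real (n := n) (E := E) (M := M) with
    contMDiff_mul := fun x => by
      have h := (contMDiff_mul 𝓘(ℂ, E) n (G := M)).contMDiffAt (x := x)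
      rw [contMDiffAt_iff] at h ⊢
      refine ⟨h.1, ?_⟩
      have h2 := ContDiffWithinAt.restrict_scalars ℝ h.2
      simpa using h2
    contMDiff_inv := fun x => ((contMDiff_inv 𝓘(ℂ, E) n (G := M)) x).restrict_scalars_real }

lemma mfderiv_real_apply {f : M → N} {x : M} (hf : MDifferentiableAt 𝓘(ℂ, E) 𝓘(ℂ, F) f x) (v : E) :
    (mfderiv 𝓘(ℝ, E) 𝓘(ℝ, F) f x : E → F) v = (mfderiv 𝓘(ℂ, E) 𝓘(ℂ, F) f x : E → F) v := by
  have hd := ((mdifferentiableAt_iff _ _).1 hf).2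
  have hf' : MDifferentiableAt 𝓘(ℝ, E) 𝓘(ℝ, F) f x :=
    (mdifferentiableAt_iff _ _).2 ⟨hf.continuousAt, hd.restrictScalars ℝ⟩
  rw [hf.mfderiv, hf'.mfderiv]
  simp only [ModelWithCorners.range_eq_univ, fderivWithin_univ, writtenInExtChartAt,
    differentiableWithinAt_univ] at hd ⊢
  exact congrArg (fun T : E →L[ℝ] F => T v) (hd.fderiv_restrictScalars ℝ)

end RealStructure

/-! ### The multiplication in charts and right-invariant fields -/

section LocalGroup

variable {E : Type*} [NormedAddCommGroup E]
  {H : Type*} [TopologicalSpace H] [ChartedSpace E H] [Group H]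

variable (E) in
/-- Left multiplication by the elements near the identity, in the charts at `1` and `q`. -/
def localAct (q : H) (p : E × E) : E :=
  chartAt E q ((chartAt E (1 : H)).symm p.1 * (chartAt E q).symm p.2)

lemma localAct_one_left {q : H} {y : E} (hy : y ∈ (chartAt E q).target) :
    localAct E q (chartAt E (1 : H) 1, y) = y := by
  simp [localAct, (chartAt E q).right_inv hy]

lemma localAct_one_right {x : E} (hx : x ∈ (chartAt E (1 : H)).target) :
    localAct E (1 : H) (x, chartAt E (1 : H) 1) = x := by
  simp [localAct, (chartAt E (1 : H)).right_inv hx]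

lemma eventually_localAct_one_left (q : H) :
    ∀ᶠ z in 𝓝 (chartAt E q q), localAct E q (chartAt E (1 : H) 1, z) = z :=
  Filter.eventually_of_mem ((chartAt E q).open_target.mem_nhds (mem_chart_target E q))
    fun _ => localAct_one_left

lemma eventually_localAct_one_right :
    ∀ᶠ z in 𝓝 (chartAt E (1 : H) 1), localAct E (1 : H) (z, chartAt E (1 : H) 1) = z :=
  Filter.eventually_of_mem ((chartAt E (1 : H)).open_target.mem_nhds (mem_chart_target E (1 : H)))
    fun _ => localAct_one_right

variable [NormedSpace ℝ E]

variable (E) in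
/-- The value at `q` of the right-invariant vector field with value `X` at the identity. -/
def rightField (X : E) (q : H) : E := (mfderiv 𝓘(ℝ, E) 𝓘(ℝ, E) (fun z : H => z * q) 1 : E → E) X

variable [LieGroup 𝓘(ℝ, E) ∞ H]

lemma contDiffAt_localAct {q : H} {y : E} (hy : y ∈ (chartAt E q).target) :
    ContDiffAt ℝ ∞ (localAct E q) (chartAt E (1 : H) 1, y) := by
  have : IsManifold 𝓘(ℝ, E) ∞ H := inferInstance
  rw [← contMDiffAt_iff_contDiffAt]
  set φ := chartAt E (1 : H)
  set e := chartAt E q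
  have h1 : ContMDiffAt 𝓘(ℝ, E) 𝓘(ℝ, E) ∞ φ.symm (φ 1) :=
    (contMDiffOn_chart_symm (x := (1 : H))).contMDiffAt
      (φ.open_target.mem_nhds (mem_chart_target E (1 : H)))
  have h2 : ContMDiffAt 𝓘(ℝ, E) 𝓘(ℝ, E) ∞ e.symm y :=
    (contMDiffOn_chart_symm (x := q)).contMDiffAt (e.open_target.mem_nhds hy)
  have h3 : ContMDiffAt 𝓘(ℝ, E × E) 𝓘(ℝ, E) ∞
      (fun p : E × E => φ.symm p.1 * e.symm p.2) (φ 1, y) :=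
    (h1.comp (φ 1, y) contDiff_fst.contMDiff.contMDiffAt).mul (h2.comp (φ 1, y) contDiff_snd.contMDiff.contMDiffAt)
  have h4 : ContMDiffAt 𝓘(ℝ, E) 𝓘(ℝ, E) ∞ e (φ.symm (φ 1) * e.symm y) := by
    refine (contMDiffOn_chart (x := q)).contMDiffAt (e.open_source.mem_nhds ?_)
    rw [φ.left_inv (mem_chart_source E (1 : H)), one_mul]
    exact e.map_target hy
  exact h4.comp (φ 1, y) h3

/-- Associativity of H, valid only near the base point, where the intermediate products stay in the
chart domains. -/
lemma localAct_assoc (q : H) :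
    ∀ᶠ p in 𝓝 (chartAt E (1 : H) 1, chartAt E (1 : H) 1),
      localAct E q (p.1, localAct E q (p.2, chartAt E q q)) =
        localAct E q (localAct E (1 : H) p, chartAt E q q) := by
  set φ := chartAt E (1 : H)
  set e := chartAt E q
  have hs : ContinuousAt φ.symm (φ 1) := φ.continuousAt_symm (mem_chart_target E (1 : H))
  have hφ : φ.symm (φ 1) = 1 := φ.left_inv (mem_chart_source E (1 : H))
  have : IsTopologicalGroup H := topologicalGroup_of_lieGroup 𝓘(ℝ, E) ∞
  have h1 : ContinuousAt (fun p : E × E => φ.symm p.1 * φ.symm p.2) (φ 1, φ 1) :=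
    (hs.comp (x := (φ 1, φ 1)) continuousAt_fst).mul
      (hs.comp (x := (φ 1, φ 1)) continuousAt_snd)
  have h2 : ContinuousAt (fun p : E × E => φ.symm p.2 * q) (φ 1, φ 1) :=
    (hs.comp (x := (φ 1, φ 1)) continuousAt_snd).mul continuousAt_const
  filter_upwards [h1.preimage_mem_nhds (φ.open_source.mem_nhds (by
      simp [hφ, φ, mem_chart_source])),
    h2.preimage_mem_nhds (e.open_source.mem_nhds (by simp [hφ, e, mem_chart_source]))] with p hp hp'
  simp only [Set.mem_preimage] at hp hp'
  have he : e.symm (e q) = q := e.left_inv (mem_chart_source E q)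
  change e (φ.symm p.1 * e.symm (e (φ.symm p.2 * e.symm (e q)))) =
    e (φ.symm (φ (φ.symm p.1 * φ.symm p.2)) * e.symm (e q))
  rw [he, e.left_inv hp', φ.left_inv hp, mul_assoc]

/-- The tangent space at 1 is identified with E through this very chart. -/
lemma mfderiv_chartAt_one_symm : (mfderiv 𝓘(ℝ, E) 𝓘(ℝ, E) (chartAt E (1 : H)).symm
    (chartAt E (1 : H) 1) : E → E) = id := by
  have : IsManifold 𝓘(ℝ, E) 1 H := IsManifold.of_le (n := ∞) (by simp)
  have h := mfderivWithin_range_extChartAt_symm (I := 𝓘(ℝ, E)) (x := (1 : H))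
  simp only [ModelWithCorners.range_eq_univ, mfderivWithin_univ] at h
  funext v
  exact congrArg (fun T : E →L[ℝ] E => T v) h

/-- Right-invariant fields are the infinitesimal generators of left multiplication; this is their
expression in a chart. -/
lemma fderiv_localAct {q : H} {y : E} (hy : y ∈ (chartAt E q).target) (X : E) :
    fderiv ℝ (fun x => localAct E q (x, y)) (chartAt E (1 : H) 1) X =
      (mfderiv 𝓘(ℝ, E) 𝓘(ℝ, E) (chartAt E q) ((chartAt E q).symm y) : E → E)
        (rightField E X ((chartAt E q).symm y)) := by
  have : IsManifold 𝓘(ℝ, E) 1 H := IsManifold.of_le (n := ∞) (by simp)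
  set φ := chartAt E (1 : H)
  set e := chartAt E q
  set p := e.symm y
  have hφ : φ.symm (φ 1) = 1 := φ.left_inv (mem_chart_source E (1 : H))
  have h1 : HasMFDerivAt 𝓘(ℝ, E) 𝓘(ℝ, E) φ.symm (φ 1) (mfderiv 𝓘(ℝ, E) 𝓘(ℝ, E) φ.symm (φ 1)) :=
    (mdifferentiableAt_atlas_symm (chart_mem_atlas E (1 : H))
      (mem_chart_target E (1 : H))).hasMFDerivAt
  have h2 : HasMFDerivAt 𝓘(ℝ, E) 𝓘(ℝ, E) (fun z : H => z * p) (φ.symm (φ 1))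
      (mfderiv 𝓘(ℝ, E) 𝓘(ℝ, E) (fun z : H => z * p) (φ.symm (φ 1))) :=
    ((contMDiff_mul_right (n := ∞)).mdifferentiableAt (by simp)).hasMFDerivAt
  have h3 : HasMFDerivAt 𝓘(ℝ, E) 𝓘(ℝ, E) e (φ.symm (φ 1) * p)
      (mfderiv 𝓘(ℝ, E) 𝓘(ℝ, E) e (φ.symm (φ 1) * p)) := by
    refine (mdifferentiableAt_atlas (chart_mem_atlas E q) ?_).hasMFDerivAt
    rw [hφ, one_mul]
    exact e.map_target hy
  have h4 := (h3.comp (φ 1) (h2.comp (φ 1) h1)).mfderiv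
  have h5 := congrArg (fun T : E →L[ℝ] E => T X) (mfderiv_eq_fderiv.symm.trans h4)
  refine h5.trans ?_
  have h6 := congrFun (mfderiv_chartAt_one_symm (E := E) (H := H)) X
  change (mfderiv 𝓘(ℝ, E) 𝓘(ℝ, E) e (φ.symm (φ 1) * p) : E → E)
    ((mfderiv 𝓘(ℝ, E) 𝓘(ℝ, E) (fun z : H => z * p) (φ.symm (φ 1)) : E → E)
    ((mfderiv 𝓘(ℝ, E) 𝓘(ℝ, E) φ.symm (φ 1) : E → E) X)) = _
  rw [h6, hφ, one_mul]
  rfl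

end LocalGroup

section LocalBracket

variable {E : Type*} [NormedAddCommGroup E] [NormedSpace ℝ E]
  {H : Type*} [TopologicalSpace H] [ChartedSpace E H] [Group H] [LieGroup 𝓘(ℝ, E) ∞ H]

/-- The counterpart for left-invariant fields, needed because these define the bracket of
`GroupLieAlgebra`. -/
lemma fderiv_localAct_right {y : E} (hy : y ∈ (chartAt E (1 : H)).target) (X : E) :
    fderiv ℝ (fun x => localAct E (1 : H) (y, x)) (chartAt E (1 : H) 1) X =
      (mfderiv 𝓘(ℝ, E) 𝓘(ℝ, E) (chartAt E (1 : H)) ((chartAt E (1 : H)).symm y) : E → E)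
        ((mfderiv 𝓘(ℝ, E) 𝓘(ℝ, E) (fun z : H => (chartAt E (1 : H)).symm y * z) 1 : E → E) X) := by
  have : IsManifold 𝓘(ℝ, E) 1 H := IsManifold.of_le (n := ∞) (by simp)
  set φ := chartAt E (1 : H)
  set p := φ.symm y
  have hφ : φ.symm (φ 1) = 1 := φ.left_inv (mem_chart_source E (1 : H))
  have h1 : HasMFDerivAt 𝓘(ℝ, E) 𝓘(ℝ, E) φ.symm (φ 1) (mfderiv 𝓘(ℝ, E) 𝓘(ℝ, E) φ.symm (φ 1)) :=
    (mdifferentiableAt_atlas_symm (chart_mem_atlas E (1 : H))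
      (mem_chart_target E (1 : H))).hasMFDerivAt
  have h2 : HasMFDerivAt 𝓘(ℝ, E) 𝓘(ℝ, E) (fun z : H => p * z) (φ.symm (φ 1))
      (mfderiv 𝓘(ℝ, E) 𝓘(ℝ, E) (fun z : H => p * z) (φ.symm (φ 1))) :=
    ((contMDiff_mul_left (n := ∞)).mdifferentiableAt (by simp)).hasMFDerivAt
  have h3 : HasMFDerivAt 𝓘(ℝ, E) 𝓘(ℝ, E) φ (p * φ.symm (φ 1))
      (mfderiv 𝓘(ℝ, E) 𝓘(ℝ, E) φ (p * φ.symm (φ 1))) := by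
    refine (mdifferentiableAt_atlas (chart_mem_atlas E (1 : H)) ?_).hasMFDerivAt
    rw [hφ, mul_one]
    exact φ.map_target hy
  have h4 := (h3.comp (φ 1) (h2.comp (φ 1) h1)).mfderiv
  have h5 := congrArg (fun T : E →L[ℝ] E => T X) (mfderiv_eq_fderiv.symm.trans h4)
  refine h5.trans ?_
  have h6 := congrFun (mfderiv_chartAt_one_symm (E := E) (H := H)) X
  change (mfderiv 𝓘(ℝ, E) 𝓘(ℝ, E) φ (p * φ.symm (φ 1)) : E → E)
    ((mfderiv 𝓘(ℝ, E) 𝓘(ℝ, E) (fun z : H => p * z) (φ.symm (φ 1)) : E → E)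
    ((mfderiv 𝓘(ℝ, E) 𝓘(ℝ, E) φ.symm (φ 1) : E → E) X)) = _
  rw [h6, hφ, mul_one]
  rfl

variable (E H) in
/-- The Lie bracket of a Lie group, computed in the chart at the identity. -/
def localBracket (X Y : E) : E := mulBracket (localAct E (1 : H)) (chartAt E (1 : H) 1) X Y

lemma contDiffAt_two_localAct (q : H) :
    ContDiffAt ℝ 2 (localAct E q) (chartAt E (1 : H) 1, chartAt E q q) :=
  (contDiffAt_localAct (mem_chart_target E q)).of_le ENat.LEInfty.out

end LocalBracket

/-! ### The Lie bracket of 𝔤 in the chart at the identity -/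

section ComplexBracket

variable {E : Type*} [NormedAddCommGroup E] [NormedSpace ℂ E]
  {G : Type*} [TopologicalSpace G] [ChartedSpace E G] [Group G] [LieGroup 𝓘(ℂ, E) ω G]

lemma mpullbackWithin_mulInvariantVectorField (X : E) {y : E}
    (hy : y ∈ (chartAt E (1 : G)).target) :
    (VectorField.mpullbackWithin 𝓘(ℂ, E) 𝓘(ℂ, E) (extChartAt 𝓘(ℂ, E) (1 : G)).symm
      (mulInvariantVectorField (G := G) (I := 𝓘(ℂ, E)) X) (Set.range 𝓘(ℂ, E)) y : E) =
    fderiv ℝ (fun x => localAct E (1 : G) (y, x)) (chartAt E (1 : G) 1) X := by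
  have : LieGroup 𝓘(ℝ, E) ω G := lieGroup_real
  have : LieGroup 𝓘(ℝ, E) ∞ G := LieGroup.of_le (n := ω) (by simp)
  have : IsManifold 𝓘(ℂ, E) 1 G := IsManifold.of_le (n := ω) (by simp)
  have hy' : y ∈ (extChartAt 𝓘(ℂ, E) (1 : G)).target := by simpa using hy
  have hinv := ContinuousLinearMap.inverse_eq
    (mfderivWithin_extChartAt_symm_comp_mfderiv_extChartAt hy')
    (mfderiv_extChartAt_comp_mfderivWithin_extChartAt_symm hy')
  have h1 : MDifferentiableAt 𝓘(ℂ, E) 𝓘(ℂ, E) (chartAt E (1 : G)) ((chartAt E (1 : G)).symm y) :=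
    mdifferentiableAt_atlas (chart_mem_atlas E (1 : G)) ((chartAt E (1 : G)).map_target hy)
  have h2 : MDifferentiableAt 𝓘(ℂ, E) 𝓘(ℂ, E) (fun z : G => (chartAt E (1 : G)).symm y * z) 1 :=
    (contMDiff_mul_left (n := ω)).mdifferentiableAt (by simp)
  refine Eq.trans ?_ (fderiv_localAct_right hy X).symm
  exact (congrArg (fun T : E →L[ℂ] E => T (mulInvariantVectorField (G := G) (I := 𝓘(ℂ, E)) X
    ((chartAt E (1 : G)).symm y))) hinv).trans <|
    ((congrArg (mfderiv 𝓘(ℝ, E) 𝓘(ℝ, E) (chartAt E (1 : G)) ((chartAt E (1 : G)).symm y) : E → E)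
      (mfderiv_real_apply h2 X)).trans (mfderiv_real_apply h1 _)).symm

/-- In the chart, the left-invariant field of Y takes the value Y at the unit, and its derivative
there along X is the mixed derivative of the multiplication. The complex and real derivatives of
this field agree because it is complex differentiable. -/
theorem lie_eq_localBracket [CompleteSpace E] (X Y : LieAlg E G) : ⁅X, Y⁆ = localBracket E G X Y := by
  have : LieGroup 𝓘(ℝ, E) ω G := lieGroup_real
  have : LieGroup 𝓘(ℝ, E) ∞ G := LieGroup.of_le (n := ω) (by simp)
  have : IsManifold 𝓘(ℂ, E) 1 G := IsManifold.of_le (n := ω) (by simp)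
  have : IsManifold 𝓘(ℂ, E) 2 G := IsManifold.of_le (n := ω) (by simp)
  set φ := chartAt E (1 : G) with hφ
  let P (X : E) : E → E := VectorField.mpullbackWithin 𝓘(ℂ, E) 𝓘(ℂ, E)
    (extChartAt 𝓘(ℂ, E) (1 : G)).symm (mulInvariantVectorField (G := G) (I := 𝓘(ℂ, E)) X)
    (Set.range 𝓘(ℂ, E))
  have hP (X : E) : P X =ᶠ[𝓝 (φ 1)] fun y =>
      fderiv ℝ (fun x => localAct E (1 : G) (y, x)) (φ 1) X :=
    Filter.eventually_of_mem (φ.open_target.mem_nhds (mem_chart_target E (1 : G)))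
      fun _ hy => mpullbackWithin_mulInvariantVectorField X hy
  have hd (X : E) : DifferentiableAt ℂ (P X) (φ 1) := by
    have h : DifferentiableWithinAt ℂ (P X) ((extChartAt 𝓘(ℂ, E) (1 : G)).symm ⁻¹' Set.univ ∩
        Set.range 𝓘(ℂ, E)) (φ 1) :=
      (mdifferentiableAt_mulInvariantVectorField (I := 𝓘(ℂ, E)) X
      (g := (1 : G))).mdifferentiableWithinAt (s := Set.univ)
      |>.differentiableWithinAt_mpullbackWithin_vectorField
    simpa only [Set.preimage_univ, Set.univ_inter, ModelWithCorners.range_eq_univ,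
      differentiableWithinAt_univ] using h
  have hval (X : E) : P X (φ 1) = X := by
    have h : (fun x => localAct E (1 : G) (φ 1, x)) =ᶠ[𝓝 (φ 1)] id :=
      eventually_localAct_one_left (1 : G)
    rw [(hP X).eq_of_nhds, h.fderiv_eq, fderiv_id]
    rfl
  have hder (X Y : E) : fderiv ℂ (P Y) (φ 1) X =
      mixedDeriv (localAct E (1 : G)) (φ 1, φ 1) X Y := by
    rw [← fderiv_fderiv_partial_right (contDiffAt_two_localAct (1 : G)), ← hφ, ← (hP Y).fderiv_eq]
    exact congrArg (fun T : E →L[ℝ] E => T X) ((hd Y).fderiv_restrictScalars ℝ).symm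
  let T : E →L[ℂ] E := mfderiv 𝓘(ℂ, E) 𝓘(ℂ, E) (extChartAt 𝓘(ℂ, E) (1 : G)) 1
  have hid : T = ContinuousLinearMap.id ℂ E := mfderiv_extChartAt_self
  have hmain (X Y : E) : T.inverse (VectorField.lieBracketWithin ℂ (P X) (P Y)
      (Set.univ ∩ Set.range 𝓘(ℂ, E)) (φ 1)) = localBracket E G X Y := by
    rw [hid, ContinuousLinearMap.inverse_id, ModelWithCorners.range_eq_univ, Set.univ_inter,
      VectorField.lieBracketWithin_univ, VectorField.lieBracket_eq]
    change fderiv ℂ (P Y) (φ 1) (P X (φ 1)) - fderiv ℂ (P X) (φ 1) (P Y (φ 1)) = _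
    rw [hval, hval, hder, hder]
    rfl
  exact hmain X Y

end ComplexBracket

/-! ### 𝔤₀ is closed under the bracket -/

section Subalgebra

variable {E : Type*} [NormedAddCommGroup E] [NormedSpace ℂ E] [CompleteSpace E]
  {G : Type*} [TopologicalSpace G] [ChartedSpace E G] [Group G] [LieGroup 𝓘(ℂ, E) ω G]
  {E₀ : Type*} [NormedAddCommGroup E₀] [NormedSpace ℝ E₀]
  {G₀ : Type*} [TopologicalSpace G₀] [ChartedSpace E₀ G₀] [Group G₀] [LieGroup 𝓘(ℝ, E₀) ∞ G₀]

/-- In the charts at the identities ι is a germ f of a homomorphism of local group laws, so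
`fderiv_mulBracket` applies. -/
lemma diffAtOne_localBracket {ι : G₀ →* G} (hι : ContMDiff 𝓘(ℝ, E₀) 𝓘(ℝ, E) ∞ ι)
    (u v : GroupLieAlgebra 𝓘(ℝ, E₀) G₀) :
    ⁅diffAtOne E E₀ ι u, diffAtOne E E₀ ι v⁆ = diffAtOne E E₀ ι (localBracket E₀ G₀ u v) := by
  have : LieGroup 𝓘(ℝ, E) ω G := lieGroup_real
  have : LieGroup 𝓘(ℝ, E) ∞ G := LieGroup.of_le (n := ω) (by simp)
  set φ := chartAt E (1 : G)
  set φ₀ := chartAt E₀ (1 : G₀)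
  have hφ : φ.symm (φ 1) = 1 := φ.left_inv (mem_chart_source E (1 : G))
  have hφ₀ : φ₀.symm (φ₀ 1) = 1 := φ₀.left_inv (mem_chart_source E₀ (1 : G₀))
  let f : E₀ → E := fun x => φ (ι (φ₀.symm x))
  have hf1 : f (φ₀ 1) = φ 1 := by simp only [f, hφ₀, map_one]
  have hf : ContDiffAt ℝ 2 f (φ₀ 1) := by
    have h := (contMDiffAt_iff.1 (hι 1)).2
    rw [map_one] at h
    simp only [ModelWithCorners.range_eq_univ, contDiffWithinAt_univ] at h
    exact ContDiffAt.of_le h ENat.LEInfty.out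
  have hdiff (w : E₀) : diffAtOne E E₀ ι w = fderiv ℝ f (φ₀ 1) w := by
    have h := (hι 1).mdifferentiableAt (by simp)
    have h2 : mfderiv 𝓘(ℝ, E₀) 𝓘(ℝ, E) ι 1 = fderiv ℝ f (φ₀ 1) := by
      rw [h.mfderiv]
      simp only [ModelWithCorners.range_eq_univ, fderivWithin_univ, writtenInExtChartAt, map_one]
      rfl
    exact congrArg (fun T : E₀ →L[ℝ] E => T w) h2
  have hcont : ContinuousAt (fun p : E₀ × E₀ => φ₀.symm p.1 * φ₀.symm p.2) (φ₀ 1, φ₀ 1) := by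
    have : IsTopologicalGroup G₀ := topologicalGroup_of_lieGroup 𝓘(ℝ, E₀) ∞
    have hs : ContinuousAt φ₀.symm (φ₀ 1) := φ₀.continuousAt_symm (mem_chart_target E₀ (1 : G₀))
    exact (hs.comp (x := (φ₀ 1, φ₀ 1)) continuousAt_fst).mul
      (hs.comp (x := (φ₀ 1, φ₀ 1)) continuousAt_snd)
  have hιc (x : E₀) (hx : x = φ₀ 1) : ContinuousAt (fun x => ι (φ₀.symm x)) x := by
    subst hx
    exact hι.continuous.continuousAt.comp (φ₀.continuousAt_symm (mem_chart_target E₀ (1 : G₀)))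
  have hsrc : ∀ᶠ x in 𝓝 (φ₀ 1), ι (φ₀.symm x) ∈ φ.source :=
    (hιc _ rfl).preimage_mem_nhds (φ.open_source.mem_nhds (by
      simp only [hφ₀, map_one]; exact mem_chart_source E (1 : G)))
  have hhom : ∀ᶠ p in 𝓝 (φ₀ 1, φ₀ 1),
      f (localAct E₀ (1 : G₀) p) = localAct E (1 : G) (f p.1, f p.2) := by
    have hfst : Filter.Tendsto (Prod.fst : E₀ × E₀ → E₀) (𝓝 (φ₀ 1, φ₀ 1)) (𝓝 (φ₀ 1)) :=
      continuousAt_fst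
    have hsnd : Filter.Tendsto (Prod.snd : E₀ × E₀ → E₀) (𝓝 (φ₀ 1, φ₀ 1)) (𝓝 (φ₀ 1)) :=
      continuousAt_snd
    filter_upwards [hcont.preimage_mem_nhds (φ₀.open_source.mem_nhds (by
        simp [hφ₀, φ₀, mem_chart_source])), hfst.eventually hsrc, hsnd.eventually hsrc]
      with p h1 h2 h3
    change φ (ι (φ₀.symm (φ₀ (φ₀.symm p.1 * φ₀.symm p.2)))) =
      φ (φ.symm (φ (ι (φ₀.symm p.1))) * φ.symm (φ (ι (φ₀.symm p.2))))
    rw [φ₀.left_inv h1, φ.left_inv h2, φ.left_inv h3, map_mul]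
  have key := fderiv_mulBracket (m := localAct E (1 : G)) (contDiffAt_two_localAct (1 : G₀))
    (by rw [hf1]; exact contDiffAt_two_localAct (1 : G)) hf
    (eventually_localAct_one_left (1 : G₀)) eventually_localAct_one_right hhom u v
  rw [hf1] at key
  exact (lie_eq_localBracket _ _).trans ((congrArg₂ (mulBracket (localAct E (1 : G)) (φ 1))
    (hdiff u) (hdiff v)).trans (key.symm.trans (hdiff _).symm))

lemma lie_mem_subLieAlg {ι : G₀ →* G} (hι : ContMDiff 𝓘(ℝ, E₀) 𝓘(ℝ, E) ∞ ι) :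
    ∀ x ∈ subLieAlg E E₀ ι, ∀ y ∈ subLieAlg E E₀ ι, ⁅x, y⁆ ∈ subLieAlg E E₀ ι := by
  rintro _ ⟨u, rfl⟩ _ ⟨v, rfl⟩
  exact ⟨_, (diffAtOne_localBracket hι u v).symm⟩

end Subalgebra

lemma _root_.ContDiffAt.continuousAlternatingMap_two_apply {A B : Type*} [NormedAddCommGroup A]
    [NormedSpace ℝ A] [NormedAddCommGroup B] [NormedSpace ℝ B] {n : WithTop ℕ∞}
    {η : B → A [⋀^Fin 2]→L[ℝ] ℝ} {a b : B → A} {x : B} (hη : ContDiffAt ℝ n η x)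
    (ha : ContDiffAt ℝ n a x) (hb : ContDiffAt ℝ n b x) :
    ContDiffAt ℝ n (fun y => η y ![a y, b y]) x := by
  obtain ⟨T, hT⟩ : ∃ T : (A [⋀^Fin 2]→L[ℝ] ℝ) →L[ℝ] A →L[ℝ] A →L[ℝ] ℝ,
      ∀ ζ u v, ζ ![u, v] = T ζ u v := by
    refine ⟨(((continuousMultilinearCurryFin1 ℝ A ℝ).toContinuousLinearEquiv :
      (A [×1]→L[ℝ] ℝ) →L[ℝ] A →L[ℝ] ℝ).postcomp A).comp
      (((continuousMultilinearCurryLeftEquiv ℝ (fun _ : Fin 2 => A) ℝ).toContinuousLinearEquiv :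
      (A [×2]→L[ℝ] ℝ) →L[ℝ] A →L[ℝ] (A [×1]→L[ℝ] ℝ)).comp
      (ContinuousAlternatingMap.toContinuousMultilinearMapCLM ℝ)), fun ζ u v => ?_⟩
    simp
  simp_rw [hT]
  have h1 : ContDiffAt ℝ n (fun y => T (η y)) x := contDiffAt_const.clm_apply hη
  exact (h1.clm_apply ha).clm_apply hb

/-- Cartan's formula in degree two, unfolded from the general sum over indices. -/
lemma extDeriv_two_apply_vectorField {A : Type*} [NormedAddCommGroup A] [NormedSpace ℝ A]
    {η : A → A [⋀^Fin 2]→L[ℝ] ℝ} {a b c : A → A} {x : A} (hη : DifferentiableAt ℝ η x)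
    (ha : DifferentiableAt ℝ a x) (hb : DifferentiableAt ℝ b x) (hc : DifferentiableAt ℝ c x) :
    extDeriv η x ![a x, b x, c x] =
      fderiv ℝ (fun y => η y ![b y, c y]) x (a x) - fderiv ℝ (fun y => η y ![a y, c y]) x (b x) +
        fderiv ℝ (fun y => η y ![a y, b y]) x (c x) -
      (η x ![VectorField.lieBracket ℝ a b x, c x] - η x ![VectorField.lieBracket ℝ a c x, b x] +
        η x ![VectorField.lieBracket ℝ b c x, a x]) := by
  have main := extDeriv_apply_vectorField (V := ![a, b, c]) hη
    (by intro i; fin_cases i <;> assumption)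
  rw [Fin.sum_univ_three, Fin.sum_univ_two, show Finset.Ici (0 : Fin 2) = {0, 1} by decide,
    show Finset.Ici (1 : Fin 2) = {1} by decide] at main
  have r (y : A) : (fun i => ![a, b, c] i y) = ![a y, b y, c y] := by
    ext i; fin_cases i <;> rfl
  have r0 (y : A) : (0 : Fin 3).removeNth ![a y, b y, c y] = ![b y, c y] := by
    ext i; fin_cases i <;> rfl
  have r1 (y : A) : (1 : Fin 3).removeNth ![a y, b y, c y] = ![a y, c y] := by
    ext i; fin_cases i <;> rfl
  have r2 (y : A) : (2 : Fin 3).removeNth ![a y, b y, c y] = ![a y, b y] := by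
    ext i; fin_cases i <;> rfl
  have t (u : A) (f : Fin 1 → A) : Matrix.vecCons u f = ![u, f 0] := by
    ext i; fin_cases i <;> rfl
  simp only [r, r0, r1, r2] at main
  rw [main]
  simp
  rw [t (VectorField.lieBracket ℝ a b x), t (VectorField.lieBracket ℝ a c x),
    t (VectorField.lieBracket ℝ b c x)]
  have s1 : (1 : Fin 2).removeNth ![b x, c x] 0 = b x := rfl
  have s2 : (1 : Fin 2).removeNth ((1 : Fin 3).removeNth ![a x, b x, c x]) 0 = a x := rfl
  rw [s1, s2]
  simp [sub_eq_add_neg]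

/-! ### Coefficients of a two-form on right-invariant fields -/

section Coefficients

variable {E : Type*} [NormedAddCommGroup E] [NormedSpace ℂ E]
  {G : Type*} [TopologicalSpace G] [ChartedSpace E G]

lemma IsKahlerFormOn.contDiffAt_formInChart {Ω : TwoForm E G} {U : Set G} (h : IsKahlerFormOn U Ω) {q : G} (hq : q ∈ U) :
    ContDiffAt ℝ ∞ (formInChart Ω (chartAt E q)) (chartAt E q q) := by
  refine (h.smooth _ (chart_mem_atlas E q)).contDiffAt ?_
  refine Filter.inter_mem ((chartAt E q).open_target.mem_nhds (mem_chart_target E q)) ?_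
  refine ((chartAt E q).continuousAt_symm (mem_chart_target E q)).preimage_mem_nhds
    (h.isOpen.mem_nhds ?_)
  rwa [(chartAt E q).left_inv (mem_chart_source E q)]

variable [Group G]

/-- The value of a two-form at a point, as a form on the model space. -/
def formAt (Ω : TwoForm E G) (q : G) : E [⋀^Fin 2]→L[ℝ] ℝ := Ω q

/-- The coefficient of a two-form with respect to two right-invariant vector fields. -/
def coeff (Ω : TwoForm E G) (X Y : E) (q : G) : ℝ :=
  formAt Ω q ![rightField E X q, rightField E Y q]

lemma rightField_add (X Y : E) (q : G) :
    rightField E (X + Y) q = rightField E X q + rightField E Y q :=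
  map_add (mfderiv 𝓘(ℝ, E) 𝓘(ℝ, E) (fun z : G => z * q) 1 : E →L[ℝ] E) X Y

lemma rightField_smul (c : ℝ) (X : E) (q : G) : rightField E (c • X) q = c • rightField E X q :=
  map_smul (mfderiv 𝓘(ℝ, E) 𝓘(ℝ, E) (fun z : G => z * q) 1 : E →L[ℝ] E) c X

lemma coeff_add_left (Ω : TwoForm E G) (X Y Z : E) (q : G) :
    coeff Ω (X + Y) Z q = coeff Ω X Z q + coeff Ω Y Z q := by
  rw [coeff, rightField_add]
  exact (formAt Ω q).toAlternatingMap.map_vecCons_add ![rightField E Z q] _ _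

lemma coeff_smul_left (Ω : TwoForm E G) (c : ℝ) (X Z : E) (q : G) :
    coeff Ω (c • X) Z q = c * coeff Ω X Z q := by
  rw [coeff, rightField_smul]
  exact (formAt Ω q).toAlternatingMap.map_vecCons_smul ![rightField E Z q] _ _

lemma coeff_swap (Ω : TwoForm E G) (X Y : E) (q : G) : coeff Ω X Y q = - coeff Ω Y X q := by
  have h := (formAt Ω q).toAlternatingMap.map_swap ![rightField E X q, rightField E Y q]
    (i := 0) (j := 1) (by simp)
  have h2 : (![rightField E X q, rightField E Y q] ∘ Equiv.swap 0 1 : Fin 2 → E) =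
    ![rightField E Y q, rightField E X q] := by
    ext i; fin_cases i <;> simp
  have h3 : coeff Ω Y X q = - coeff Ω X Y q := by
    rw [coeff, ← h2]; exact h
  rw [h3, neg_neg]

/-- The right-invariant vector field in the chart at `q`. -/
def chartField (q : G) (X : E) (y : E) : E :=
  fderiv ℝ (fun x => localAct E q (x, y)) (chartAt E (1 : G) 1) X

variable [LieGroup 𝓘(ℝ, E) ∞ G] {Ω : TwoForm E G} {U : Set G}

lemma contDiffAt_chartField {q : G} (X : E) {y : E} (hy : y ∈ (chartAt E q).target) :
    ContDiffAt ℝ ∞ (chartField q X) y :=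
  contDiffAt_fderiv_partial_left (contDiffAt_localAct hy) X

lemma chartField_self (q : G) (X : E) : chartField q X (chartAt E q q) = rightField E X q := by
  have : IsManifold 𝓘(ℝ, E) 1 G := IsManifold.of_le (n := ∞) (by simp)
  rw [chartField, fderiv_localAct (mem_chart_target E q),
    (chartAt E q).left_inv (mem_chart_source E q)]
  exact congrArg (fun T : E →L[ℝ] E => T (rightField E X q))
    (mfderiv_extChartAt_self (I := 𝓘(ℝ, E)) (x := q))

lemma coeff_chartAt_symm (Ω : TwoForm E G) {q : G} (X Y : E) {y : E}
    (hy : y ∈ (chartAt E q).target) :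
    coeff Ω X Y ((chartAt E q).symm y) =
      formInChart Ω (chartAt E q) y ![chartField q X y, chartField q Y y] := by
  have : IsManifold 𝓘(ℝ, E) 1 G := IsManifold.of_le (n := ∞) (by simp)
  set e := chartAt E q
  have hid (v : E) : (mfderiv 𝓘(ℝ, E) 𝓘(ℝ, E) e.symm y : E → E)
      ((mfderiv 𝓘(ℝ, E) 𝓘(ℝ, E) e (e.symm y) : E → E) v) = v := by
    have h := (mdifferentiable_chart (I := 𝓘(ℝ, E)) q).symm_comp_deriv (e.map_target hy)
    rw [e.right_inv hy] at h
    exact congrArg (fun T : E →L[ℝ] E => T v) h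
  let T : E → E := mfderiv 𝓘(ℝ, E) 𝓘(ℝ, E) e.symm y
  have hX (X : E) : T (chartField q X y) = rightField E X (e.symm y) := by
    exact (congrArg (mfderiv 𝓘(ℝ, E) 𝓘(ℝ, E) e.symm y : E → E) (fderiv_localAct hy X)).trans (hid _)
  change formAt Ω (e.symm y) ![rightField E X (e.symm y), rightField E Y (e.symm y)] =
    formAt Ω (e.symm y) (fun i => T (![chartField q X y, chartField q Y y] i))
  congr 1
  ext i
  fin_cases i
  · exact (hX X).symm
  · exact (hX Y).symm

lemma IsKahlerFormOn.contDiffAt_formInChart_apply (h : IsKahlerFormOn U Ω) {q : G} (hq : q ∈ U)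
    (X Y : E) :
    ContDiffAt ℝ ∞ (fun y => formInChart Ω (chartAt E q) y ![chartField q X y, chartField q Y y])
      (chartAt E q q) :=
  (h.contDiffAt_formInChart hq).continuousAlternatingMap_two_apply
    (contDiffAt_chartField X (mem_chart_target E q))
    (contDiffAt_chartField Y (mem_chart_target E q))

lemma coeff_comp_eventuallyEq (Ω : TwoForm E G) (q : G) (X Y : E) :
    coeff Ω X Y ∘ (chartAt E q).symm =ᶠ[𝓝 (chartAt E q q)]
      fun y => formInChart Ω (chartAt E q) y ![chartField q X y, chartField q Y y] :=
  Filter.eventually_of_mem ((chartAt E q).open_target.mem_nhds (mem_chart_target E q))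
    fun _ hy => coeff_chartAt_symm Ω X Y hy

lemma IsKahlerFormOn.contMDiffAt_coeff (h : IsKahlerFormOn U Ω) {q : G} (hq : q ∈ U) (X Y : E) :
    ContMDiffAt 𝓘(ℝ, E) 𝓘(ℝ, ℝ) ∞ (coeff Ω X Y) q := by
  have h1 := (h.contDiffAt_formInChart_apply hq X Y).congr_of_eventuallyEq
    (coeff_comp_eventuallyEq Ω q X Y)
  rw [contMDiffAt_iff]
  refine ⟨?_, ?_⟩
  · have h2 : ContinuousAt ((coeff Ω X Y ∘ (chartAt E q).symm) ∘ chartAt E q) q :=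
      ContinuousAt.comp h1.continuousAt ((chartAt E q).continuousAt (mem_chart_source E q))
    refine h2.congr (Filter.eventually_of_mem
      ((chartAt E q).open_source.mem_nhds (mem_chart_source E q)) fun z hz => ?_)
    simp [(chartAt E q).left_inv hz]
  · simpa using! h1

lemma IsKahlerFormOn.mfderiv_coeff (h : IsKahlerFormOn U Ω) {q : G} (hq : q ∈ U) (X Y v : E) :
    (mfderiv 𝓘(ℝ, E) 𝓘(ℝ, ℝ) (coeff Ω X Y) q : E → ℝ) v =
      fderiv ℝ (fun y => formInChart Ω (chartAt E q) y ![chartField q X y, chartField q Y y])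
        (chartAt E q q) v := by
  have h1 := (h.contMDiffAt_coeff hq X Y).mdifferentiableAt (by simp)
  rw [h1.mfderiv]
  simp only [ModelWithCorners.range_eq_univ, fderivWithin_univ]
  exact congrArg (fun T : E →L[ℝ] ℝ => T v) (coeff_comp_eventuallyEq Ω q X Y).fderiv_eq

/-- The derivative of a coefficient of a two-form along a right-invariant vector field. -/
def coeffDeriv (Ω : TwoForm E G) (X Y Z : E) (q : G) : ℝ :=
  (mfderiv 𝓘(ℝ, E) 𝓘(ℝ, ℝ) (coeff Ω Y Z) q : E → ℝ) (rightField E X q)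

/-- The minus sign is that of generators of a left action; it makes the bracket terms in
`closed_coeff` appear with a plus sign. -/
lemma lieBracket_chartField (q : G) (X Y : E) :
    VectorField.lieBracket ℝ (chartField q X) (chartField q Y) (chartAt E q q) =
      - rightField E (localBracket E G X Y) q := by
  rw [← chartField_self]
  exact lieBracket_generator (contDiffAt_two_localAct (1 : G)) (contDiffAt_two_localAct q)
    (eventually_localAct_one_left (1 : G)) eventually_localAct_one_right
    (localAct_one_left (mem_chart_target E q)) (localAct_assoc q) X Y

lemma formInChart_self (Ω : TwoForm E G) (q : G) (v w : E) :
    formInChart Ω (chartAt E q) (chartAt E q q) ![v, w] = formAt Ω q ![v, w] := by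
  have : IsManifold 𝓘(ℝ, E) 1 G := IsManifold.of_le (n := ∞) (by simp)
  set e := chartAt E q
  have hid (v : E) : (mfderiv 𝓘(ℝ, E) 𝓘(ℝ, E) e.symm (e q) : E → E) v = v := by
    have h := mfderivWithin_range_extChartAt_symm (I := 𝓘(ℝ, E)) (x := q)
    simp only [ModelWithCorners.range_eq_univ, mfderivWithin_univ] at h
    exact congrArg (fun T : E →L[ℝ] E => T v) h
  change formAt Ω (e.symm (e q)) (fun i =>
    (mfderiv 𝓘(ℝ, E) 𝓘(ℝ, E) e.symm (e q) : E → E) (![v, w] i)) = _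
  rw [funext fun i => hid _, e.left_inv (mem_chart_source E q)]

/-- Closedness of a two-form, expressed in terms of its coefficients. -/
theorem IsKahlerFormOn.closed_coeff (h : IsKahlerFormOn U Ω) {q : G} (hq : q ∈ U) (X Y Z : E) :
    coeffDeriv Ω X Y Z q + coeffDeriv Ω Y Z X q + coeffDeriv Ω Z X Y q +
      (coeff Ω (localBracket E G X Y) Z q + coeff Ω (localBracket E G Y Z) X q +
        coeff Ω (localBracket E G Z X) Y q) = 0 := by
  set e := chartAt E q
  have h0 : extDeriv (formInChart Ω e) (e q) = 0 := h.closed e (chart_mem_atlas E q) (e q)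
    ⟨mem_chart_target E q, by
      rwa [Set.mem_preimage, e.left_inv (mem_chart_source E q)]⟩
  have hξ (X : E) : DifferentiableAt ℝ (chartField q X) (e q) :=
    (contDiffAt_chartField X (mem_chart_target E q)).differentiableAt (by simp)
  have main := extDeriv_two_apply_vectorField
    ((h.contDiffAt_formInChart hq).differentiableAt (by simp)) (hξ X) (hξ Y) (hξ Z)
  have hη (u v : E) : formInChart Ω e (e q) ![-u, v] = - formAt Ω q ![u, v] := by
    rw [formInChart_self]
    have := (formAt Ω q).toAlternatingMap.map_vecCons_smul ![v] (-1) u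
    simpa using! this
  have hswap : coeffDeriv Ω Y Z X q = - coeffDeriv Ω Y X Z q := by
    have hfun : coeff Ω Z X = - coeff Ω X Z := funext fun p => coeff_swap Ω Z X p
    rw [coeffDeriv, hfun, mfderiv_neg]
    rfl
  have hbr : localBracket E G Z X = - localBracket E G X Z := by
    simp [localBracket, mulBracket]
  have hneg (u v : E) : coeff Ω (-u) v q = - coeff Ω u v q := by
    simpa using coeff_smul_left Ω (-1) u v q
  rw [h0, lieBracket_chartField, lieBracket_chartField, lieBracket_chartField, hη, hη, hη,
    chartField_self, chartField_self, chartField_self,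
    ← h.mfderiv_coeff hq, ← h.mfderiv_coeff hq, ← h.mfderiv_coeff hq] at main
  rw [hswap, hbr, hneg]
  change (0 : ℝ) = coeffDeriv Ω X Y Z q - coeffDeriv Ω Y X Z q + coeffDeriv Ω Z X Y q -
    (- coeff Ω (localBracket E G X Y) Z q - - coeff Ω (localBracket E G X Z) Y q +
      - coeff Ω (localBracket E G Y Z) X q) at main
  linarith

end Coefficients

/-! ### Behaviour of the coefficients under right translations and J -/

section Invariance

variable {E : Type*} [NormedAddCommGroup E] [NormedSpace ℂ E]
  {G : Type*} [TopologicalSpace G] [ChartedSpace E G] [Group G] {Ω : TwoForm E G} {U : Set G}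

lemma rightField_one (X : E) : rightField E X (1 : G) = X := by
  have h : (fun z : G => z * 1) = id := by ext; simp
  rw [rightField, h, mfderiv_id]
  rfl

lemma formAtOne_eq_coeff (Ω : TwoForm E G) (X Y : LieAlg E G) :
    formAtOne Ω X Y = coeff Ω X Y 1 := by
  have h (X Y : E) : coeff Ω X Y 1 = formAt Ω (1 : G) ![X, Y] := by
    rw [coeff, rightField_one, rightField_one]
  exact (h X Y).symm

lemma coeff_add_right (Ω : TwoForm E G) (X Y Z : E) (q : G) :
    coeff Ω X (Y + Z) q = coeff Ω X Y q + coeff Ω X Z q := by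
  rw [coeff_swap, coeff_add_left, coeff_swap Ω X Y, coeff_swap Ω X Z]
  ring

lemma coeff_smul_right (Ω : TwoForm E G) (c : ℝ) (X Y : E) (q : G) :
    coeff Ω X (c • Y) q = c * coeff Ω X Y q := by
  rw [coeff_swap, coeff_smul_left, coeff_swap Ω X Y]
  ring

section Real

variable [LieGroup 𝓘(ℝ, E) ∞ G]

lemma hasMFDerivAt_mul_right (s q : G) : HasMFDerivAt 𝓘(ℝ, E) 𝓘(ℝ, E) (fun z : G => z * s) q
    (mfderiv 𝓘(ℝ, E) 𝓘(ℝ, E) (fun z : G => z * s) q) :=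
  ((contMDiff_mul_right (n := ∞)).mdifferentiableAt (by simp)).hasMFDerivAt

lemma rightField_mul (X : E) (q s : G) : rightField E X (q * s) =
    (mfderiv 𝓘(ℝ, E) 𝓘(ℝ, E) (fun z : G => z * s) q : E → E) (rightField E X q) := by
  have h : (fun z : G => z * (q * s)) = (fun z => z * s) ∘ fun z => z * q := by
    ext z; simp [mul_assoc]
  have h1 := ((hasMFDerivAt_mul_right (E := E) s (1 * q)).comp 1
    (hasMFDerivAt_mul_right q 1)).mfderiv
  rw [rightField, h]
  refine (congrArg (fun T : E →L[ℝ] E => T X) h1).trans ?_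
  change (mfderiv 𝓘(ℝ, E) 𝓘(ℝ, E) (fun z : G => z * s) (1 * q) : E → E) (rightField E X q) = _
  rw [one_mul]

lemma rightField_ne_zero {X : E} (hX : X ≠ 0) (q : G) : rightField E X q ≠ 0 := by
  intro h
  apply hX
  have h1 := rightField_mul X q q⁻¹
  rw [h, mul_inv_cancel, rightField_one] at h1
  rw [h1]
  exact map_zero (mfderiv 𝓘(ℝ, E) 𝓘(ℝ, E) (fun z : G => z * q⁻¹) q : E →L[ℝ] E)

/-- Right translations carry right-invariant fields to themselves, so invariance of the form becomes
invariance of a scalar function. -/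
lemma IsRightInvariantOn.coeff_mul {S : Subgroup G} (h : IsRightInvariantOn S U Ω) {q s : G}
    (hq : q ∈ U) (hs : s ∈ S) (X Y : E) : coeff Ω X Y (q * s) = coeff Ω X Y q := by
  have h1 := congrArg (fun T : E [⋀^Fin 2]→L[ℝ] ℝ => T ![rightField E X q, rightField E Y q])
    (h.pullback q hq s hs)
  refine Eq.trans ?_ h1
  change formAt Ω (q * s) ![rightField E X (q * s), rightField E Y (q * s)] =
    formAt Ω (q * s) (fun i => (mfderiv 𝓘(ℝ, E) 𝓘(ℝ, E) (fun z : G => z * s) q : E → E)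
      (![rightField E X q, rightField E Y q] i))
  congr 1
  ext i
  fin_cases i
  · exact rightField_mul X q s
  · exact rightField_mul Y q s

end Real

variable [LieGroup 𝓘(ℂ, E) ω G]

lemma rightField_I_smul (X : E) (q : G) :
    rightField E (Complex.I • X) q = Complex.I • rightField E X q := by
  have h : MDifferentiableAt 𝓘(ℂ, E) 𝓘(ℂ, E) (fun z : G => z * q) 1 :=
    (contMDiff_mul_right (n := ω)).mdifferentiableAt (by simp)
  rw [rightField, rightField, mfderiv_real_apply h, mfderiv_real_apply h]
  exact map_smul (mfderiv 𝓘(ℂ, E) 𝓘(ℂ, E) (fun z : G => z * q) 1 : E →L[ℂ] E) _ X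

lemma IsKahlerFormOn.coeff_I_smul (h : IsKahlerFormOn U Ω) {q : G} (hq : q ∈ U) (X Y : E) :
    coeff Ω (Complex.I • X) (Complex.I • Y) q = coeff Ω X Y q := by
  rw [coeff, rightField_I_smul, rightField_I_smul]
  exact h.invariant q hq (rightField E X q) (rightField E Y q)

lemma IsKahlerFormOn.coeff_pos [LieGroup 𝓘(ℝ, E) ∞ G] (h : IsKahlerFormOn U Ω) {q : G}
    (hq : q ∈ U) {X : E} (hX : X ≠ 0) : 0 < coeff Ω (Complex.I • X) X q := by
  rw [coeff, rightField_I_smul]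
  exact h.pos q hq (rightField E X q) (rightField_ne_zero hX q)

end Invariance

/-! ### Differentiating coefficients along G₀ -/

section Curve

variable {E₀ : Type*} [NormedAddCommGroup E₀] [NormedSpace ℝ E₀]
  {G₀ : Type*} [TopologicalSpace G₀] [ChartedSpace E₀ G₀] [Group G₀]

variable (E₀ G₀) in
/-- A smooth curve through the identity with initial velocity `u`. -/
def curve (u : E₀) (t : ℝ) : G₀ := (chartAt E₀ (1 : G₀)).symm (chartAt E₀ (1 : G₀) 1 + t • u)

lemma curve_zero (u : E₀) : curve E₀ G₀ u 0 = 1 := by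
  simp [curve, (chartAt E₀ (1 : G₀)).left_inv (mem_chart_source E₀ (1 : G₀))]

end Curve

section Restriction

variable {E : Type*} [NormedAddCommGroup E] [NormedSpace ℂ E]
  {G : Type*} [TopologicalSpace G] [ChartedSpace E G] [Group G] [LieGroup 𝓘(ℝ, E) ∞ G]
  {E₀ : Type*} [NormedAddCommGroup E₀] [NormedSpace ℝ E₀]
  {G₀ : Type*} [TopologicalSpace G₀] [ChartedSpace E₀ G₀] [Group G₀] [LieGroup 𝓘(ℝ, E₀) ∞ G₀]
  {Ω : TwoForm E G} {U : Set G} {ι : G₀ →* G}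

lemma contMDiffAt_curve (u : E₀) : ContMDiffAt 𝓘(ℝ, ℝ) 𝓘(ℝ, E₀) ∞ (curve E₀ G₀ u) 0 := by
  have h1 : ContMDiffAt 𝓘(ℝ, ℝ) 𝓘(ℝ, E₀) ∞ (fun t : ℝ => chartAt E₀ (1 : G₀) 1 + t • u) 0 :=
    (contDiff_const.add (contDiff_id.smul contDiff_const)).contMDiff.contMDiffAt
  have h2 : ContMDiffAt 𝓘(ℝ, E₀) 𝓘(ℝ, E₀) ∞ (chartAt E₀ (1 : G₀)).symm
      (chartAt E₀ (1 : G₀) 1 + (0 : ℝ) • u) := by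
    rw [zero_smul, add_zero]
    exact (contMDiffOn_chart_symm (x := (1 : G₀))).contMDiffAt
      ((chartAt E₀ (1 : G₀)).open_target.mem_nhds (mem_chart_target E₀ (1 : G₀)))
  exact h2.comp 0 h1

lemma mfderiv_curve (u : E₀) :
    (mfderiv 𝓘(ℝ, ℝ) 𝓘(ℝ, E₀) (curve E₀ G₀ u) 0 : ℝ → E₀) 1 = u := by
  have h1 : HasMFDerivAt 𝓘(ℝ, ℝ) 𝓘(ℝ, E₀) (fun t : ℝ => chartAt E₀ (1 : G₀) 1 + t • u) 0
      (ContinuousLinearMap.toSpanSingleton ℝ u) := by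
    refine HasFDerivAt.hasMFDerivAt ?_
    have h := (((hasDerivAt_id (0 : ℝ)).smul_const u).const_add (chartAt E₀ (1 : G₀) 1)).hasFDerivAt
    rwa [one_smul] at h
  have h2 : HasMFDerivAt 𝓘(ℝ, E₀) 𝓘(ℝ, E₀) (chartAt E₀ (1 : G₀)).symm
      (chartAt E₀ (1 : G₀) 1 + (0 : ℝ) • u)
      (mfderiv 𝓘(ℝ, E₀) 𝓘(ℝ, E₀) (chartAt E₀ (1 : G₀)).symm
        (chartAt E₀ (1 : G₀) 1 + (0 : ℝ) • u)) := by
    refine (mdifferentiableAt_atlas_symm (chart_mem_atlas E₀ (1 : G₀)) ?_).hasMFDerivAt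
    rw [zero_smul, add_zero]
    exact mem_chart_target E₀ (1 : G₀)
  have h3 := congrArg (fun T : ℝ →L[ℝ] E₀ => T 1) (h2.comp 0 h1).mfderiv
  refine h3.trans ?_
  change (mfderiv 𝓘(ℝ, E₀) 𝓘(ℝ, E₀) (chartAt E₀ (1 : G₀)).symm
        (chartAt E₀ (1 : G₀) 1 + (0 : ℝ) • u) : E₀ → E₀) ((1 : ℝ) • u) = u
  rw [zero_smul, add_zero, mfderiv_chartAt_one_symm, one_smul]
  rfl

/-- For X in 𝔤₀, deriving along the right-invariant field of X is deriving under left translation by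
a curve in G₀. An arbitrary curve with the right velocity suffices, so no exponential map is needed.
-/
lemma IsKahlerFormOn.hasDerivAt_coeff (h : IsKahlerFormOn U Ω)
    (hι : ContMDiff 𝓘(ℝ, E₀) 𝓘(ℝ, E) ∞ ι) (u : E₀) (Y Z : E) {g : G₀} (hg : ι g ∈ U) :
    HasDerivAt (fun t => coeff Ω Y Z (ι (curve E₀ G₀ u t * g)))
      (coeffDeriv Ω (diffAtOne E E₀ ι u) Y Z (ι g)) 0 := by
  have h1 := ((contMDiffAt_curve (G₀ := G₀) u).mdifferentiableAt (by simp)).hasMFDerivAt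
  have h2 := ((hι 1).mdifferentiableAt (by simp)).hasMFDerivAt
  rw [← curve_zero u] at h2
  have h3 := hasMFDerivAt_mul_right (E := E) (ι g) (ι (curve E₀ G₀ u 0))
  have h4 : HasMFDerivAt 𝓘(ℝ, E) 𝓘(ℝ, ℝ) (coeff Ω Y Z) (ι (curve E₀ G₀ u 0) * ι g)
      (mfderiv 𝓘(ℝ, E) 𝓘(ℝ, ℝ) (coeff Ω Y Z) (ι (curve E₀ G₀ u 0) * ι g)) := by
    refine ((h.contMDiffAt_coeff ?_ Y Z).mdifferentiableAt (by simp)).hasMFDerivAt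
    rwa [curve_zero, map_one, one_mul]
  obtain ⟨T, hT, hT1⟩ : ∃ T : ℝ →L[ℝ] ℝ,
      HasFDerivAt (coeff Ω Y Z ∘ (fun z => z * ι g) ∘ ι ∘ curve E₀ G₀ u) T 0 ∧
        T 1 = coeffDeriv Ω (diffAtOne E E₀ ι u) Y Z (ι g) := by
    refine ⟨_, (h4.comp 0 (h3.comp 0 (h2.comp 0 h1))).hasFDerivAt, ?_⟩
    change (mfderiv 𝓘(ℝ, E) 𝓘(ℝ, ℝ) (coeff Ω Y Z) (ι (curve E₀ G₀ u 0) * ι g) : E → ℝ)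
      ((mfderiv 𝓘(ℝ, E) 𝓘(ℝ, E) (fun z : G => z * ι g) (ι (curve E₀ G₀ u 0)) : E → E)
        ((mfderiv 𝓘(ℝ, E₀) 𝓘(ℝ, E) ι (curve E₀ G₀ u 0) : E₀ → E)
          ((mfderiv 𝓘(ℝ, ℝ) 𝓘(ℝ, E₀) (curve E₀ G₀ u) 0 : ℝ → E₀) 1))) = _
    rw [mfderiv_curve, curve_zero, map_one, one_mul]
    rfl
  have hfun : (fun t => coeff Ω Y Z (ι (curve E₀ G₀ u t * g))) =
      coeff Ω Y Z ∘ (fun z => z * ι g) ∘ ι ∘ curve E₀ G₀ u := by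
    ext t
    simp
  rw [hfun, ← hT1]
  exact hT.hasDerivAt

end Restriction

/-! ### An invariant form gives a Kähler form on 𝔤 -/

section PartOne

variable {E : Type*} [NormedAddCommGroup E] [NormedSpace ℂ E] [CompleteSpace E]
  {G : Type*} [TopologicalSpace G] [ChartedSpace E G] [Group G] [LieGroup 𝓘(ℂ, E) ω G]
  {E₀ : Type*} [NormedAddCommGroup E₀] [NormedSpace ℝ E₀]
  {G₀ : Type*} [TopologicalSpace G₀] [ChartedSpace E₀ G₀] [Group G₀] [LieGroup 𝓘(ℝ, E₀) ∞ G₀]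
  {Ω : TwoForm E G} {U : Set G} {ι : G₀ →* G}

/-- The value of a two-form at the identity, as a bilinear form on the Lie algebra. -/
def bilinAtOne (Ω : TwoForm E G) : LieAlg E G →ₗ[ℝ] LieAlg E G →ₗ[ℝ] ℝ :=
  LinearMap.mk₂ ℝ (fun X Y => coeff Ω X Y 1) (fun X Y Z => coeff_add_left Ω X Y Z 1)
    (fun c X Y => coeff_smul_left Ω c X Y 1) (fun X Y Z => coeff_add_right Ω X Y Z 1)
    (fun c X Y => coeff_smul_right Ω c X Y 1)

lemma IsKahlerFormOn.isKahlerOn_bilinAtOne (h : IsKahlerFormOn U Ω)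
    (hinv : IsRightInvariantOn ι.range U Ω) (hU : (1 : G) ∈ U)
    (hι : ContMDiff 𝓘(ℝ, E₀) 𝓘(ℝ, E) ∞ ι) :
    IsKahlerOn (subLieAlg E E₀ ι) (bilinAtOne Ω) := by
  have : LieGroup 𝓘(ℝ, E) ω G := lieGroup_real
  have : LieGroup 𝓘(ℝ, E) ∞ G := LieGroup.of_le (n := ω) (by simp)
  refine ⟨fun X => ?_, fun X Y => h.coeff_I_smul hU X Y, fun X hX => h.coeff_pos hU hX, ?_⟩
  · have := coeff_swap Ω X X 1
    change coeff Ω X X 1 = 0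
    linarith
  -- The coefficients are constant along G₀, so only the algebraic part of `closed_coeff` remains.
  have hder : ∀ X ∈ subLieAlg E E₀ ι, ∀ Y Z : E, coeffDeriv Ω X Y Z 1 = 0 := by
    rintro _ ⟨u, rfl⟩ Y Z
    have hd := h.hasDerivAt_coeff hι u Y Z (g := 1) (by rwa [map_one])
    have hc : (fun t => coeff Ω Y Z (ι (curve E₀ G₀ u t * 1))) = fun _ => coeff Ω Y Z 1 := by
      ext t
      rw [← hinv.coeff_mul hU ⟨curve E₀ G₀ u t * 1, rfl⟩ Y Z, one_mul]
    rw [hc, map_one] at hd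
    exact hd.unique (hasDerivAt_const _ _)
  intro X hX Y hY Z hZ
  have hcl := h.closed_coeff hU X Y Z
  rw [hder X hX Y Z, hder Y hY Z X, hder Z hZ X Y] at hcl
  have hlie (X Y Z : LieAlg E G) : bilinAtOne Ω ⁅X, Y⁆ Z = coeff Ω (localBracket E G X Y) Z 1 :=
    congrArg (fun W : E => coeff Ω W Z 1) (lie_eq_localBracket X Y)
  rw [hlie, hlie, hlie]
  linarith

end PartOne

/-! ### Positive functionals and differentiation in the sup norm -/

section UniformDerivative

variable {Y : Type*} [TopologicalSpace Y] [CompactSpace Y]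

/-- Pointwise differentiability in a parameter, with jointly continuous derivative, is uniform over
a compact space. -/
lemma hasDerivAt_continuousMap {f : ℝ → C(Y, ℝ)} {k : ℝ → Y → ℝ} {d : C(Y, ℝ)}
    (hd : ∀ y, d y = k 0 y)
    (hf : ∀ y, ∀ᶠ p in 𝓝 ((0 : ℝ), y), HasDerivAt (fun t => f t p.2) (k p.1 p.2) p.1)
    (hk : ∀ y, ContinuousAt (Function.uncurry k) ((0 : ℝ), y)) : HasDerivAt f d 0 := by
  rw [hasDerivAt_iff_isLittleO_nhds_zero, Asymptotics.isLittleO_iff]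
  intro ε hε
  have hunif : ∀ᶠ s in 𝓝 (0 : ℝ), ∀ y ∈ (Set.univ : Set Y),
      HasDerivAt (fun t => f t y) (k s y) s ∧ |k s y - k 0 y| ≤ ε := by
    refine isCompact_univ.eventually_forall_of_forall_eventually fun y _ => ?_
    refine (hf y).and ?_
    have h1 : ContinuousAt (fun p : ℝ × Y => k p.1 p.2 - k 0 p.2) (0, y) := by
      refine (hk y).sub ?_
      exact ContinuousAt.comp (g := Function.uncurry k) (f := fun p : ℝ × Y => ((0 : ℝ), p.2))
        (hk y) (by fun_prop)
    have h2 : ∀ᶠ p in 𝓝 ((0 : ℝ), y), |k p.1 p.2 - k 0 p.2| < ε :=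
      h1.abs.eventually (gt_mem_nhds (by simpa using hε))
    exact h2.mono fun _ h => h.le
  obtain ⟨δ, hδ, hball⟩ := Metric.eventually_nhds_iff_ball.1 hunif
  filter_upwards [Metric.ball_mem_nhds (0 : ℝ) hδ] with t ht
  rw [zero_add, ContinuousMap.norm_le _ (by positivity)]
  intro y
  -- Mean value inequality for f s y - s * k 0 y, whose derivative is at most ε on a ball
  -- independent of y.
  have hbound := (convex_ball (0 : ℝ) δ).norm_image_sub_le_of_norm_hasDerivWithin_le
    (f := fun s => f s y - s * k 0 y) (f' := fun s => k s y - k 0 y) (C := ε)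
    (fun s hs => (((hball s hs y trivial).1.sub
      (by simpa using (hasDerivAt_id s).mul_const (k 0 y))).hasDerivWithinAt))
    (fun s hs => by simpa using (hball s hs y trivial).2) (Metric.mem_ball_self hδ) ht
  simp only [zero_mul, sub_zero] at hbound
  calc ‖(f t - f 0 - t • d) y‖ = ‖f t y - t * k 0 y - f 0 y‖ := by
        simp [hd y]; ring_nf
    _ ≤ ε * ‖t‖ := hbound

lemma abs_le_norm_of_positive {M : C(Y, ℝ) →ₗ[ℝ] ℝ} (hpos : ∀ f : C(Y, ℝ), (∀ y, 0 ≤ f y) → 0 ≤ M f)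
    (hone : M 1 = 1) (f : C(Y, ℝ)) : |M f| ≤ ‖f‖ := by
  have h1 := hpos (‖f‖ • 1 + f) fun y => by
    have := (abs_le.1 (f.norm_coe_le_norm y)).1
    simp; linarith
  have h2 := hpos (‖f‖ • 1 - f) fun y => by
    have := (abs_le.1 (f.norm_coe_le_norm y)).2
    simp; linarith
  rw [map_add, map_smul, hone] at h1
  rw [map_sub, map_smul, hone] at h2
  simp only [smul_eq_mul, mul_one] at h1 h2
  exact abs_le.2 ⟨by linarith, by linarith⟩

/-- A positive function on a compact space is bounded below by its positive minimum, so M f is at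
least that minimum. -/
lemma pos_of_forall_pos {M : C(Y, ℝ) →ₗ[ℝ] ℝ} (hpos : ∀ f : C(Y, ℝ), (∀ y, 0 ≤ f y) → 0 ≤ M f)
    (hone : M 1 = 1) [Nonempty Y] {f : C(Y, ℝ)} (hf : ∀ y, 0 < f y) : 0 < M f := by
  obtain ⟨y₀, -, hy₀⟩ := isCompact_univ.exists_isMinOn Set.univ_nonempty f.continuous.continuousOn
  have h := hpos (f - f y₀ • 1) fun y => by
    have := hy₀ (Set.mem_univ y)
    simpa using! this
  rw [map_sub, map_smul, hone, smul_eq_mul, mul_one] at h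
  linarith [hf y₀]

/-- A positive functional which is constant along a differentiable curve vanishes on its
derivative. -/
lemma map_deriv_eq_zero {M : C(Y, ℝ) →ₗ[ℝ] ℝ}
    (hpos : ∀ f : C(Y, ℝ), (∀ y, 0 ≤ f y) → 0 ≤ M f) (hone : M 1 = 1) {f : ℝ → C(Y, ℝ)} {d : C(Y, ℝ)}
    (hf : HasDerivAt f d 0) (hM : ∀ t, M (f t) = M (f 0)) : M d = 0 := by
  let M' : C(Y, ℝ) →L[ℝ] ℝ := M.mkContinuous 1 fun f => by
    simpa using abs_le_norm_of_positive hpos hone f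
  have h1 : HasDerivAt (fun t => M (f t)) (M d) 0 := M'.hasFDerivAt.comp_hasDerivAt 0 hf
  rw [funext hM] at h1
  exact h1.unique (hasDerivAt_const _ _)

end UniformDerivative

/-! ### Descending functions to G₀/Γ -/

section Quotient

variable {H : Type*} [Group H] [TopologicalSpace H] [IsTopologicalGroup H] {Γ : Subgroup H}

/-- The function on the quotient `H ⧸ Γ` induced by a continuous right-`Γ`-invariant function. -/
def quotientFun (f : H → ℝ) (hf : Continuous f) (hinv : ∀ g, ∀ γ ∈ Γ, f (g * γ) = f g) :
    C(H ⧸ Γ, ℝ) where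
  toFun := Quotient.lift f fun a b hab => by
    have h := hinv a (a⁻¹ * b) (QuotientGroup.leftRel_apply.1 hab)
    rw [mul_inv_cancel_left] at h
    exact h.symm
  continuous_toFun := hf.quotient_lift _

lemma isOpenQuotientMap_prodMap_mk :
    IsOpenQuotientMap (Prod.map id QuotientGroup.mk : ℝ × H → ℝ × H ⧸ Γ) :=
  IsOpenQuotientMap.id.prodMap QuotientGroup.isOpenQuotientMap_mk

end Quotient

section ParameterDerivative

variable {E₀ : Type*} [NormedAddCommGroup E₀] [NormedSpace ℝ E₀]
  {M : Type*} [TopologicalSpace M] [ChartedSpace E₀ M] [IsManifold 𝓘(ℝ, E₀) ∞ M]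

/-- The derivative of a smooth function on `ℝ × M` in the real variable is continuous. -/
lemma continuousAt_deriv_param {f : ℝ → M → ℝ} {g : M}
    (hf : ContMDiffAt (𝓘(ℝ, ℝ).prod 𝓘(ℝ, E₀)) 𝓘(ℝ, ℝ) ∞ (Function.uncurry f) (0, g)) :
    (∀ᶠ p in 𝓝 ((0 : ℝ), g), DifferentiableAt ℝ (fun t => f t p.2) p.1) ∧
      ContinuousAt (fun p : ℝ × M => deriv (fun t => f t p.2) p.1) (0, g) := by
  set e := chartAt E₀ g
  have heg : e.symm (e g) = g := e.left_inv (mem_chart_source E₀ g)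
  let F : ℝ × E₀ → ℝ := fun p => f p.1 (e.symm p.2)
  have hF : ContDiffAt ℝ ∞ F (0, e g) := by
    rw [← contMDiffAt_iff_contDiffAt]
    have h1 : ContMDiffAt 𝓘(ℝ, E₀) 𝓘(ℝ, E₀) ∞ e.symm (e g) :=
      (contMDiffOn_chart_symm (x := g)).contMDiffAt (e.open_target.mem_nhds (mem_chart_target E₀ g))
    have h2 : ContMDiffAt 𝓘(ℝ, ℝ × E₀) (𝓘(ℝ, ℝ).prod 𝓘(ℝ, E₀)) ∞
        (fun p : ℝ × E₀ => (p.1, e.symm p.2)) (0, e g) :=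
      contDiff_fst.contMDiff.contMDiffAt.prodMk
        (h1.comp (0, e g) contDiff_snd.contMDiff.contMDiffAt)
    have h3 : ContMDiffAt (𝓘(ℝ, ℝ).prod 𝓘(ℝ, E₀)) 𝓘(ℝ, ℝ) ∞ (Function.uncurry f)
        ((fun p : ℝ × E₀ => (p.1, e.symm p.2)) (0, e g)) := by
      simpa only [heg] using hf
    exact h3.comp (0, e g) h2
  have hF2 : ContDiffAt ℝ 2 F (0, e g) := hF.of_le ENat.LEInfty.out
  have hcont : ContinuousAt (fun p : ℝ × M => (p.1, e p.2)) (0, g) :=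
    continuousAt_fst.prodMk ((e.continuousAt (mem_chart_source E₀ g)).comp
      (x := ((0 : ℝ), g)) continuousAt_snd)
  have hsrc : ∀ᶠ p : ℝ × M in 𝓝 (0, g), p.2 ∈ e.source :=
    continuousAt_snd.preimage_mem_nhds (e.open_source.mem_nhds (mem_chart_source E₀ g))
  have hev : ∀ᶠ p in 𝓝 ((0 : ℝ), g), DifferentiableAt ℝ (fun t => f t p.2) p.1 ∧
      deriv (fun t => f t p.2) p.1 = fderiv ℝ F (p.1, e p.2) (1, 0) := by
    filter_upwards [hsrc, hcont.eventually hF2.eventually_differentiableAt] with p hp hd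
    have hfun : (fun t => f t p.2) = fun t => F (t, e p.2) := by
      ext t
      simp only [F, e.left_inv hp]
    have h1 : DifferentiableAt ℝ (fun t => F (t, e p.2)) p.1 :=
      DifferentiableAt.comp p.1 (g := F) (f := fun t => (t, e p.2)) hd
        (differentiableAt_id.prodMk (differentiableAt_const _))
    rw [hfun]
    exact ⟨h1, by rw [← hd.fderiv_partial_left, fderiv_apply_one_eq_deriv]⟩
  refine ⟨hev.mono fun _ h => h.1, ?_⟩
  have h2 : ContinuousAt (fun q : ℝ × E₀ => fderiv ℝ F q (1, 0)) (0, e g) :=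
    (hF2.differentiableAt_fderiv.continuousAt).clm_apply continuousAt_const
  have h3 : ContinuousAt (fun p : ℝ × M => fderiv ℝ F (p.1, e p.2) (1, 0)) (0, g) :=
    ContinuousAt.comp (g := fun q : ℝ × E₀ => fderiv ℝ F q (1, 0))
      (f := fun p : ℝ × M => (p.1, e p.2)) h2 hcont
  exact h3.congr (hev.mono fun _ h => h.2.symm)

end ParameterDerivative

/-! ### Averaging a Γ-invariant Kähler form over G₀/Γ -/

section Average

variable {E : Type*} [NormedAddCommGroup E] [NormedSpace ℂ E] [CompleteSpace E]
  {G : Type*} [TopologicalSpace G] [ChartedSpace E G] [Group G] [LieGroup 𝓘(ℂ, E) ω G]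
  {E₀ : Type*} [NormedAddCommGroup E₀] [NormedSpace ℝ E₀]
  {G₀ : Type*} [TopologicalSpace G₀] [ChartedSpace E₀ G₀] [Group G₀] [LieGroup 𝓘(ℝ, E₀) ∞ G₀]
  {Ω : TwoForm E G} {U : Set G} {ι : G₀ →* G} {Γ : Subgroup G₀}

/-- A form on `G` which is invariant under a cocompact subgroup of a solvable group `G₀` can be
averaged over `G₀`. -/
theorem IsKahlerFormOn.exists_isKahlerOn (h : IsKahlerFormOn U Ω)
    (hinv : IsRightInvariantOn (Γ.map ι) U Ω) (hU : ∀ g, ι g ∈ U)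
    (hι : ContMDiff 𝓘(ℝ, E₀) 𝓘(ℝ, E) ∞ ι) (hsolv : Group.IsSolvable G₀)
    (hcomp : CompactSpace (G₀ ⧸ Γ)) :
    ∃ w : LieAlg E G →ₗ[ℝ] LieAlg E G →ₗ[ℝ] ℝ, IsKahlerOn (subLieAlg E E₀ ι) w := by
  have : LieGroup 𝓘(ℝ, E) ω G := lieGroup_real
  have : LieGroup 𝓘(ℝ, E) ∞ G := LieGroup.of_le (n := ω) (by simp)
  have : IsTopologicalGroup G₀ := topologicalGroup_of_lieGroup 𝓘(ℝ, E₀) ∞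
  obtain ⟨M, hpos, hone, hM⟩ := exists_invariant_mean (Y := G₀ ⧸ Γ) hsolv
  have hcΓ (X Y : E) : ∀ g, ∀ γ ∈ Γ, coeff Ω X Y (ι (g * γ)) = coeff Ω X Y (ι g) := by
    intro g γ hγ
    rw [map_mul]
    exact hinv.coeff_mul (hU g) ⟨γ, hγ, rfl⟩ X Y
  have hcc (X Y : E) : Continuous fun g => coeff Ω X Y (ι g) :=
    continuous_iff_continuousAt.2 fun g =>
      ((h.contMDiffAt_coeff (hU g) X Y).continuousAt).comp hι.continuous.continuousAt
  let b (X Y : E) : C(G₀ ⧸ Γ, ℝ) := quotientFun (fun g => coeff Ω X Y (ι g)) (hcc X Y) (hcΓ X Y)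
  have hb (X Y : E) (g : G₀) : b X Y (QuotientGroup.mk g) = coeff Ω X Y (ι g) := rfl
  have ext_mk {f f' : C(G₀ ⧸ Γ, ℝ)} (hff : ∀ g : G₀, f (QuotientGroup.mk g) =
      f' (QuotientGroup.mk g)) : f = f' :=
    ContinuousMap.ext fun y => QuotientGroup.induction_on y hff
  let w : LieAlg E G →ₗ[ℝ] LieAlg E G →ₗ[ℝ] ℝ := LinearMap.mk₂ ℝ (fun X Y => M (b X Y))
    (fun X Y Z => by
      rw [← map_add]
      exact congrArg M (ext_mk fun g => coeff_add_left Ω X Y Z (ι g)))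
    (fun c X Y => by
      rw [← map_smul]
      exact congrArg M (ext_mk fun g => coeff_smul_left Ω c X Y (ι g)))
    (fun X Y Z => by
      rw [← map_add]
      exact congrArg M (ext_mk fun g => coeff_add_right Ω X Y Z (ι g)))
    (fun c X Y => by
      rw [← map_smul]
      exact congrArg M (ext_mk fun g => coeff_smul_right Ω c X Y (ι g)))
  -- The derivative of a coefficient along 𝔤₀ is the sup-norm derivative of its left translates on
  -- G₀/Γ. The mean is constant on these translates, hence vanishes on the derivative.
  have hder : ∀ X ∈ subLieAlg E E₀ ι, ∀ Y Z : E, ∃ d : C(G₀ ⧸ Γ, ℝ), M d = 0 ∧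
      ∀ g : G₀, d (QuotientGroup.mk g) = coeffDeriv Ω X Y Z (ι g) := by
    rintro _ ⟨u, rfl⟩ Y Z
    let f : ℝ → G₀ → ℝ := fun t g => coeff Ω Y Z (ι (curve E₀ G₀ u t * g))
    have hsmooth (g : G₀) : ContMDiffAt (𝓘(ℝ, ℝ).prod 𝓘(ℝ, E₀)) 𝓘(ℝ, ℝ) ∞ (Function.uncurry f)
        (0, g) := by
      have h1 : ContMDiffAt (𝓘(ℝ, ℝ).prod 𝓘(ℝ, E₀)) 𝓘(ℝ, E₀) ∞
          (fun p : ℝ × G₀ => curve E₀ G₀ u p.1 * p.2) (0, g) :=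
        ((contMDiffAt_curve (E₀ := E₀) (G₀ := G₀) u).comp ((0 : ℝ), g) contMDiffAt_fst).mul contMDiffAt_snd
      exact (h.contMDiffAt_coeff (hU _) Y Z).comp ((0 : ℝ), g) ((hι _).comp ((0 : ℝ), g) h1)
    have hdiff (g : G₀) : deriv (fun t => f t g) 0 = coeffDeriv Ω (diffAtOne E E₀ ι u) Y Z (ι g) :=
      (h.hasDerivAt_coeff hι u Y Z (hU g)).deriv
    have hdc : Continuous fun g => coeffDeriv Ω (diffAtOne E E₀ ι u) Y Z (ι g) := by
      simp_rw [← hdiff]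
      refine continuous_iff_continuousAt.2 fun g => ?_
      exact ContinuousAt.comp (g := fun p : ℝ × G₀ => deriv (fun t => f t p.2) p.1)
        (f := fun g => ((0 : ℝ), g)) (continuousAt_deriv_param (hsmooth g)).2 (by fun_prop)
    have hfΓ (t : ℝ) : ∀ g, ∀ γ ∈ Γ, f t (g * γ) = f t g := by
      intro g γ hγ
      simp only [f]
      rw [← mul_assoc]
      exact hcΓ Y Z _ γ hγ
    have hdΓ : ∀ g, ∀ γ ∈ Γ, coeffDeriv Ω (diffAtOne E E₀ ι u) Y Z (ι (g * γ)) =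
        coeffDeriv Ω (diffAtOne E E₀ ι u) Y Z (ι g) := by
      intro g γ hγ
      rw [← hdiff, ← hdiff]
      simp_rw [hfΓ _ g γ hγ]
    let fq : ℝ → C(G₀ ⧸ Γ, ℝ) := fun t =>
      quotientFun (f t) ((hcc Y Z).comp (continuous_const.mul continuous_id)) (hfΓ t)
    refine ⟨quotientFun _ hdc hdΓ, ?_, fun g => rfl⟩
    have hq := isOpenQuotientMap_prodMap_mk (Γ := Γ)
    have hderiv : HasDerivAt fq (quotientFun _ hdc hdΓ) 0 := by
      refine hasDerivAt_continuousMap (k := fun s y => deriv (fun t => fq t y) s) ?_ ?_ ?_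
      · intro y
        induction y using QuotientGroup.induction_on with
        | H g => exact (hdiff g).symm
      · intro y
        induction y using QuotientGroup.induction_on with
        | H g =>
          -- Neighbourhoods in ℝ × G₀/Γ are images of neighbourhoods in ℝ × G₀, because the
          -- projection is open.
          change ∀ᶠ p in 𝓝 (Prod.map id QuotientGroup.mk ((0 : ℝ), g)), _
          rw [← hq.map_nhds_eq, Filter.eventually_map]
          exact (continuousAt_deriv_param (hsmooth g)).1.mono fun p hp => hp.hasDerivAt
      · intro y
        induction y using QuotientGroup.induction_on with
        | H g =>
          exact (hq.continuousAt_comp_iff (x := ((0 : ℝ), g))).1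
            (continuousAt_deriv_param (hsmooth g)).2
    refine map_deriv_eq_zero hpos hone hderiv fun t => ?_
    have hfq (t : ℝ) : M (fq t) = M (b Y Z) :=
      hM (curve E₀ G₀ u t) _ _ fun y => QuotientGroup.induction_on y fun g => rfl
    rw [hfq, hfq]
  refine ⟨w, fun X => ?_, fun X Y => ?_, fun X hX => ?_, fun X hX Y hY Z hZ => ?_⟩
  · change M (b X X) = 0
    have h0 : b X X = 0 := ext_mk fun g => by
      have := coeff_swap Ω X X (ι g)
      change coeff Ω X X (ι g) = 0
      linarith
    rw [h0, map_zero]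
  · exact congrArg M (ext_mk fun g => h.coeff_I_smul (hU g) X Y)
  · exact pos_of_forall_pos hpos hone fun y =>
      QuotientGroup.induction_on y fun g => h.coeff_pos (hU g) hX
  · obtain ⟨d₁, hd₁, hd₁'⟩ := hder X hX Y Z
    obtain ⟨d₂, hd₂, hd₂'⟩ := hder Y hY Z X
    obtain ⟨d₃, hd₃, hd₃'⟩ := hder Z hZ X Y
    -- Closedness of the form as an identity of functions on G₀/Γ; applying the mean removes the
    -- first three terms.
    have hsum : d₁ + d₂ + d₃ + (b (localBracket E G X Y) Z + b (localBracket E G Y Z) X +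
        b (localBracket E G Z X) Y) = 0 := ext_mk fun g => by
      have := h.closed_coeff (hU g) X Y Z
      rw [← hd₁', ← hd₂', ← hd₃'] at this
      exact this
    have hMsum := congrArg M hsum
    rw [map_add, map_add, map_add, map_add, map_add, hd₁, hd₂, hd₃, map_zero] at hMsum
    have hlie (X Y Z : LieAlg E G) : w ⁅X, Y⁆ Z = M (b (localBracket E G X Y) Z) :=
      congrArg (fun W : E => M (b W Z)) (lie_eq_localBracket X Y)
    rw [hlie, hlie, hlie]
    linarith

end Average

end CRSolv

end

/-! ### The main theorem -/

theorem theorem2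
    {E : Type*} [NormedAddCommGroup E] [NormedSpace ℂ E] [FiniteDimensional ℂ E] [CompleteSpace E]
    {G : Type*} [TopologicalSpace G] [T2Space G] [SecondCountableTopology G]
    [ChartedSpace E G] [Group G] [LieGroup 𝓘(ℂ, E) ω G]
    {E₀ : Type*} [NormedAddCommGroup E₀] [NormedSpace ℝ E₀] [FiniteDimensional ℝ E₀]
    {G₀ : Type*} [TopologicalSpace G₀] [T2Space G₀] [SecondCountableTopology G₀]
    [ChartedSpace E₀ G₀] [Group G₀] [LieGroup 𝓘(ℝ, E₀) ∞ G₀]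
    (ι : G₀ →* G) (Γ : Subgroup G₀)
    (hCRS : CRSolv.IsCRS E E₀ ι Γ) (hK : CRSolv.IsLocallyKahler E ι Γ) :
    (∀ (U : Set G) (Ω : CRSolv.TwoForm E G), (∀ g : G₀, ι g ∈ U) →
      CRSolv.IsKahlerFormOn U Ω → CRSolv.IsRightInvariantOn ι.range U Ω →
      {X : CRSolv.LieAlg E G |
          X ∈ LieAlgebra.center ℂ (CRSolv.LieAlg E G) ∧ X ∈ CRSolv.crAlg E E₀ ι} =
        {X : CRSolv.LieAlg E G | X ∈ CRSolv.crAlg E E₀ ι ∧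
          ∀ W ∈ CRSolv.bracketSpan (CRSolv.crAlg E E₀ ι), CRSolv.formAtOne Ω X W = 0}) ∧
    (LieAlgebra.center ℂ (CRSolv.LieAlg E G) = ⊥ →
      CRSolv.bracketSpan (CRSolv.crAlg E E₀ ι) = CRSolv.crAlg E E₀ ι) := by
  have hsub := CRSolv.lie_mem_subLieAlg (E₀ := E₀) hCRS.smooth
  refine ⟨fun U Ω hU hΩ hinv => ?_, fun hz => ?_⟩
  · have hw := hΩ.isKahlerOn_bilinAtOne (E₀ := E₀) hinv (by simpa using hU 1) hCRS.smooth
    have key := hw.center_inter_maxComplex hsub hCRS.generic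
    refine key.trans ?_
    ext X
    refine and_congr_right fun _ => forall₂_congr fun W _ => ?_
    rw [CRSolv.formAtOne_eq_coeff]
    rfl
  · obtain ⟨V, -, hV, Ω, hΩ, hinv⟩ := hK
    have := hCRS.solvable
    -- Solvability of G passes to G₀ through the injection ι; it is what provides the invariant
    -- mean.
    have hsolv : Group.IsSolvable G₀ := Group.isSolvable_of_isSolvable_injective hCRS.injective
    obtain ⟨w, hw⟩ := hΩ.exists_isKahlerOn hinv hV hCRS.smooth hsolv hCRS.cocompact
    have : FiniteDimensional ℝ E := FiniteDimensional.complexToReal E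
    have : FiniteDimensional ℝ (CRSolv.LieAlg E G) := this
    exact hw.bracketSpan_eq hsub hCRS.generic hz
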